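/- Let $e_m(x)=\sqrt2\sin(m\pi x)$, $m\ge1$, be the orthonormal basis of the complex Hilbert space $L^2(0,1)$ consisting of eigenfunctions of the Dirichlet Laplacian, $\Delta e_m=-(m\pi)^2e_m$; write $\|\cdot\|_0$ for the $L^2(0,1)$-norm, $(f,g)=\int_0^1 f\bar g\,dx$, $V_N=\mathrm{span}_{\mathbb C}\{e_1,\dots,e_N\}$ and $\pi_N f=\sum_{m=1}^N(f,e_m)e_m$. Let $\alpha>0$, $\lambda\in\{-1,0,1\}$, and let $\eta_m\ge0$ with $\sum_{m}\eta_m<\infty$. Let $(\beta_m)_{m\ge1}$ be a family of independent $\mathbb C$-valued Wiener processes (all real and imaginary parts are independent standard real Brownian motions) on a probability space, with respect to a filtration $(\mathcal F_t)_{t\ge0}$: each $\beta_m$ is adapted and, for $s\le t$, the family of increments $(\beta_m(t)-\beta_m(s))_{m\ge1}$ is independent of $\mathcal F_s$. Let $u_0\in L^2(0,1)$ be deterministic. For a time step $\tau>0$ put $t_k=k\tau$ and consider the scheme (BE): $u_N^0=\pi_Nu_0$ and, for $k\ge1$, almost surely, $$u_N^{k}-e^{-\alpha\tau}u_N^{k-1}=\Big(\mathbf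 i\Delta u_N^{k}+\mathbf i\lambda\,\pi_N\Big(\tfrac{|u_N^{k}|^2+|e^{-\alpha\tau}u_N^{k-1}|^2}{2}u_N^{k}\Big)\Big)\tau+\sum_{m=1}^N\sqrt{\eta_m}\,\big(\beta_m(t_k)-\beta_m(t_{k-1})\big)e_m .$$ Then there is $\tau_0>0$, depending only on $\alpha$ and $N$, such that for every $0<\tau\le\tau_0$ there exists a $V_N$-valued, $(\mathcal F_{t_k})_{k\ge0}$-adapted solution $(u_N^k)_{k\ge0}$ of (BE), and it is unique up to almost sure equality. Moreover, for every integer $p\ge2$ there is a constant $C>0$, depending only on $p$, $\alpha$, $(\eta_m)_m$ and $u_N^0$ (in particular not on $k$ or $\tau$), such that $$E\|u_N^k\|_0^p\le C\qquad\text{for all } k\ge0 .$$ -/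

import Mathlib

open MeasureTheory ProbabilityTheory
open scoped NNReal

noncomputable section

namespace DampedNLS

/-- The complex Hilbert space `L²(0,1)`; its norm is `‖·‖₀`. -/
abbrev L2 : Type := Lp ℂ 2 (volume.restrict (Set.Ioo (0 : ℝ) 1))

/-- The Dirichlet eigenfunctions `√2 sin(nπx)`, `n = m + 1`, so that `m = 0, 1, 2, …`. -/
def eFun (m : ℕ) (x : ℝ) : ℂ :=
  ((Real.sqrt 2 * Real.sin (((m : ℝ) + 1) * Real.pi * x) : ℝ) : ℂ)

lemma memLp_eFun (m : ℕ) : MemLp (eFun m) 2 (volume.restrict (Set.Ioo (0 : ℝ) 1)) := by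
  have hc : Continuous (eFun m) := by unfold eFun; fun_prop
  refine MemLp.of_bound hc.aestronglyMeasurable (Real.sqrt 2) (Filter.Eventually.of_forall ?_)
  intro x
  rw [eFun, Complex.norm_real, norm_mul, Real.norm_of_nonneg (Real.sqrt_nonneg 2)]
  exact mul_le_of_le_one_right (Real.sqrt_nonneg 2) (Real.abs_sin_le_one _)

/-- The eigenfunctions as elements of `L²(0,1)`. -/
def e (m : ℕ) : L2 := (memLp_eFun m).toLp (eFun m)

/-- The coefficient `(f, e_m) = ∫₀¹ f(x) conj(e_m(x)) dx`. -/
def coeff (f : ℝ → ℂ) (m : ℕ) : ℂ :=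
  ∫ x in Set.Ioo (0 : ℝ) 1, f x * (starRingEnd ℂ) (eFun m x)

/-- `V_N`, the complex span of the first `N` eigenfunctions. -/
def V (N : ℕ) : Submodule ℂ L2 := Submodule.span ℂ (e '' {m | m < N})

/-- The spectral projection `π_N f = ∑ (f, e_m) e_m` over the first `N` modes. -/
def proj (N : ℕ) (f : ℝ → ℂ) : L2 := ∑ m ∈ Finset.range N, coeff f m • e m

/-- The Dirichlet Laplacian `Δ u = -∑ (nπ)² (u, e_n) e_n`; the series has finitely many nonzero
terms for `u ∈ V_N`. -/
def laplacian (u : L2) : L2 :=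
  ∑' m : ℕ, (-((((m : ℝ) + 1) * Real.pi) ^ 2 : ℝ) * coeff u m : ℂ) • e m

variable {Ω : Type*} {mΩ : MeasurableSpace Ω}

/-- The real (`false`) and imaginary (`true`) parts of the processes `β_m`. -/
def component (β : ℕ → ℝ≥0 → Ω → ℂ) (q : ℕ × Bool) (t : ℝ≥0) (ω : Ω) : ℝ :=
  if q.2 then (β q.1 t ω).im else (β q.1 t ω).re

/-- `(β_m)` is a family of independent `ℂ`-valued Wiener processes with respect to the
filtration `F`: all real and imaginary parts are independent standard real Brownian motions,
each `β_m` is adapted to `F`, and the increments of the family after time `s` are independent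
of `F s`. -/
structure IsWienerFamily (P : Measure Ω) (F : Filtration ℝ≥0 mΩ)
    (β : ℕ → ℝ≥0 → Ω → ℂ) : Prop where
  brownian : ∀ q : ℕ × Bool, IsBrownianReal (component β q) P
  indep : iIndepFun (fun (q : ℕ × Bool) (ω : Ω) (t : ℝ≥0) => component β q t ω) P
  adapted : ∀ m, StronglyAdapted F (β m)
  indep_past : ∀ s t : ℝ≥0, s ≤ t →
    Indep (MeasurableSpace.comap (fun ω (m : ℕ) => β m t ω - β m s ω) MeasurableSpace.pi) (F s) P

/-- The grid points `t_k = k τ`. -/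
def gridTime (τ : ℝ≥0) (k : ℕ) : ℝ≥0 := (k : ℝ≥0) * τ

/-- `π_N Q^{1/2} (W(t) - W(s)) = ∑ √η_m (β_m(t) - β_m(s)) e_m` over the first `N` modes. -/
def noise (N : ℕ) (η : ℕ → ℝ) (β : ℕ → ℝ≥0 → Ω → ℂ) (s t : ℝ≥0) (ω : Ω) : L2 :=
  ∑ m ∈ Finset.range N, ((Real.sqrt (η m) : ℂ) * (β m t ω - β m s ω)) • e m

/-- One step of the scheme, from `v` to `u`, with noise increment `g`:
`u - e^{-ατ} v = (iΔu + iλ π_N((|u|² + |e^{-ατ} v|²)/2 · u)) τ + g`. -/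
def Step (N : ℕ) (α lam : ℝ) (τ : ℝ≥0) (v u g : L2) : Prop :=
  let a : ℂ := (Real.exp (-(α * τ)) : ℂ)
  u - a • v =
    ((τ : ℝ) : ℂ) • (Complex.I • laplacian u +
      (Complex.I * (lam : ℂ)) •
        proj N (fun x => (((‖u x‖ ^ 2 + ‖a * v x‖ ^ 2) / 2 : ℝ) : ℂ) * u x)) + g

/-- `u = (u_N^k)_k` is a `V_N`-valued solution of the scheme with initial value `π_N u₀`, adapted
to `(F_{t_k})_k`. -/
structure IsAdaptedSolution (N : ℕ) (α lam : ℝ) (η : ℕ → ℝ) (u₀ : L2) (P : Measure Ω)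
    (F : Filtration ℝ≥0 mΩ) (β : ℕ → ℝ≥0 → Ω → ℂ) (τ : ℝ≥0) (u : ℕ → Ω → V N) : Prop where
  adapted : ∀ k, StronglyMeasurable[F (gridTime τ k)] (u k)
  init : ∀ᵐ ω ∂P, (u 0 ω : L2) = proj N u₀
  step : ∀ k, ∀ᵐ ω ∂P, Step N α lam τ (u k ω) (u (k + 1) ω)
    (noise N η β (gridTime τ k) (gridTime τ (k + 1)) ω)

end DampedNLS

end

/-! With `w = e^{-ατ}v`, a step reads `u - iτX_w(u) = w + g`, where `X_w(u) = Δu + λπ_N((|u|² +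
|w|²)/2 · u)`. The pairing `(u, X_w(u))` is real, hence `‖u‖ ≤ ‖w + g‖`. This one inequality gives
properness for existence and reduces all moments to those of `w + g`.

The difficulty in solvability is that `τ` may not depend on the size of the data although `X_w` is
cubic. For `d = u - v` and `D = X_w(u) - X_w(v)`, either `|Re(d, D)| ≥ ‖d‖²` or `τ‖D‖ ≤ ‖d‖/2`
(`exists_drift_dichotomy`). If `λ ≤ 0`, Laplacian and cubic term push `Re(d, D)` the same way. If `λ
= 1` they compete, but the cubic term wins once `‖u‖² + ‖v‖² + ‖w‖²` passes a threshold depending on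
`N`, and below it `X_w` is Lipschitz. In both cases the implicit map expands distances up to a fixed
factor (`norm_sub_le_implicitMap`); with properness it is a bijection whose inverse is continuous in
all data (`exists_implicit_solution`), so adaptedness is inherited.

For the moments, `‖w + g‖^{2(q+1)}` is expanded to second order. The linear term has mean zero by
independence, and the remainder costs `τ` times a lower moment. The damping then closes a recursion,
uniformly in `k`, by induction on `q` (`le_momentBound`). -/

namespace DampedNLS

/-! ### Global solvability of the implicit equation. -/

section ImplicitSolver

variable {E : Type*} [NormedAddCommGroup E] [InnerProductSpace ℂ E]

/-- The implicit map `u ↦ u - iτX(u)`. -/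
noncomputable def implicitMap (τ : ℝ) (X : E → E) (u : E) : E := u - (τ : ℂ) • (Complex.I • X u)

lemma re_inner_I_smul_self (x : E) : (inner ℂ (Complex.I • x) x).re = 0 := by
  rw [inner_smul_left, ← inner_self_ofReal_re (𝕜 := ℂ) x]
  simp

/-- The term `iτX(u)` drops out of `Re(u, u - iτX(u))`, which is therefore `‖u‖²`; Cauchy–Schwarz
finishes. -/
lemma norm_le_norm_implicitMap {τ : ℝ} {X : E → E} {u : E} (hX : (inner ℂ u (X u)).im = 0) :
    ‖u‖ ≤ ‖implicitMap τ X u‖ := by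
  have h : (inner ℂ u (implicitMap τ X u)).re = ‖u‖ ^ 2 := by
    rw [implicitMap, inner_sub_right, inner_smul_right, inner_smul_right,
      inner_self_eq_norm_sq_to_K]
    simp [hX, ← Complex.ofReal_pow]
  have h2 : ‖u‖ ^ 2 ≤ ‖u‖ * ‖implicitMap τ X u‖ := by
    rw [← h]
    exact (Complex.re_le_norm _).trans (norm_inner_le_norm _ _)
  by_contra! hlt
  nlinarith [norm_nonneg u, norm_nonneg (implicitMap τ X u)]

/-- If the increments `D` of `X` are either coercive or small compared with the increments `d` of
the argument, the implicit map expands distances by a uniform factor. -/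
lemma norm_sub_le_implicitMap {τ : ℝ} (hτ : 0 < τ) (hτ1 : τ ≤ 1) {X : E → E} {u v : E}
    (hX : ‖u - v‖ ^ 2 ≤ |(inner ℂ (u - v) (X u - X v)).re| ∨
      τ * ‖X u - X v‖ ≤ ‖u - v‖ / 2) :
    ‖u - v‖ ≤ 2 / τ * ‖implicitMap τ X u - implicitMap τ X v‖ := by
  set r := implicitMap τ X u - implicitMap τ X v with hr
  set d := u - v
  set D := X u - X v
  have hdr : d = r + (τ : ℂ) • (Complex.I • D) := by
    simp only [hr, implicitMap, d, D, smul_sub]; abel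
  have hn : ‖(τ : ℂ) • (Complex.I • D)‖ = τ * ‖D‖ := by
    rw [norm_smul, norm_smul]; simp [abs_of_pos hτ]
  have h1 : ‖d‖ ≤ ‖r‖ + τ * ‖D‖ := by
    rw [← hn]; conv_lhs => rw [hdr]
    exact norm_add_le _ _
  have h2 : τ * ‖D‖ ≤ ‖d‖ + ‖r‖ := by
    have : (τ : ℂ) • (Complex.I • D) = d - r := by rw [hdr]; abel
    rw [← hn, this]; exact norm_sub_le _ _
  have key : τ * ‖d‖ ≤ 2 * ‖r‖ := by
    have hd := norm_nonneg d
    have hr0 := norm_nonneg r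
    rcases hX with hX | hX
    -- `d - r = iτD` is real-orthogonal to `D`, so `d` may be replaced by `r`. The only size bound
    -- on `D` then needed is `τ‖D‖ ≤ ‖d‖ + ‖r‖`.
    · have h3 : (inner ℂ d D).re = (inner ℂ r D).re := by
        conv_lhs => rw [hdr]
        rw [inner_add_left, inner_smul_left, Complex.add_re]
        have := re_inner_I_smul_self D
        simp [this]
      have h4 : ‖d‖ ^ 2 ≤ ‖r‖ * ‖D‖ := hX.trans <| by
        rw [h3]; exact (Complex.abs_re_le_norm _).trans (norm_inner_le_norm _ _)
      have h5 : τ * ‖d‖ ^ 2 ≤ ‖r‖ * (‖d‖ + ‖r‖) := by nlinarith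
      by_contra! hlt
      have hdpos : 0 < ‖d‖ := by
        rcases hd.eq_or_lt with h | h
        · rw [← h] at hlt; linarith
        · exact h
      have hrd : 2 * ‖r‖ < ‖d‖ := lt_of_lt_of_le hlt (by nlinarith)
      nlinarith
    · nlinarith
  rw [div_mul_eq_mul_div, le_div_iff₀ hτ]; linarith

/-- The expansion bound passes to the limit in difference quotients along a kernel vector, forcing
it to vanish. -/
lemma injective_of_hasFDerivAt_of_norm_sub_le {F : Type*} [NormedAddCommGroup F] [NormedSpace ℝ F]
    {f : F → F} {f' : F →L[ℝ] F} {x : F} (hf : HasFDerivAt f f' x) {K : ℝ}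
    (hK : ∀ u v, ‖u - v‖ ≤ K * ‖f u - f v‖) : Function.Injective f' := by
  rw [injective_iff_map_eq_zero]
  intro h hh
  have hl : Filter.Tendsto (fun t : ℝ => t⁻¹ • (f (x + t • h) - f x)) (nhdsWithin 0 {0}ᶜ)
      (nhds (f' h)) := (hf.hasLineDerivAt h).tendsto_slope_zero
  rw [hh] at hl
  have h2 := (hl.norm.const_mul K)
  rw [norm_zero, mul_zero] at h2
  have : ‖h‖ ≤ 0 := by
    refine ge_of_tendsto h2 ?_
    filter_upwards [self_mem_nhdsWithin] with t ht
    have ht' : 0 < ‖t‖ := norm_pos_iff.2 ht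
    have := hK (x + t • h) x
    rw [add_sub_cancel_left, norm_smul] at this
    rw [norm_smul, norm_inv]
    calc ‖h‖ = ‖t‖⁻¹ * (‖t‖ * ‖h‖) := by field_simp
      _ ≤ ‖t‖⁻¹ * (K * ‖f (x + t • h) - f x‖) := by gcongr
      _ = _ := by ring
  exact norm_le_zero_iff.1 this

/-- The range is clopen: open because the derivative, injective in finite dimension, is onto; closed
because `hp` makes `f` proper. -/
lemma surjective_of_contDiff_of_norm_sub_le {F : Type*} [NormedAddCommGroup F] [NormedSpace ℝ F]
    [FiniteDimensional ℝ F] {f : F → F} (hf : ContDiff ℝ 1 f) {K : ℝ}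
    (hK : ∀ u v, ‖u - v‖ ≤ K * ‖f u - f v‖) (hp : ∀ u, ‖u‖ ≤ ‖f u‖) :
    Function.Surjective f := by
  have : ProperSpace F := FiniteDimensional.proper ℝ F
  have : CompleteSpace F := FiniteDimensional.complete ℝ F
  have hopen : IsOpen (Set.range f) := by
    rw [isOpen_iff_mem_nhds]
    rintro _ ⟨x, rfl⟩
    have hs := hf.contDiffAt.hasStrictFDerivAt (x := x) one_ne_zero
    have hsurj : Function.Surjective (fderiv ℝ f x) :=
      (LinearMap.injective_iff_surjective (f := (fderiv ℝ f x : F →ₗ[ℝ] F))).1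
        (injective_of_hasFDerivAt_of_norm_sub_le hs.hasFDerivAt hK)
    rw [← hs.map_nhds_eq_of_surj (LinearMap.range_eq_top.2 hsurj)]
    exact Filter.range_mem_map
  have hclosed : IsClosed (Set.range f) := by
    have : IsProperMap f := isProperMap_iff_tendsto_cocompact.2 ⟨hf.continuous, by
      rw [← Metric.cobounded_eq_cocompact, ← tendsto_norm_atTop_iff_cobounded]
      exact Filter.tendsto_atTop_mono hp tendsto_norm_cobounded_atTop⟩
    exact this.isClosedMap.isClosed_range
  exact Set.range_eq_univ.1 (IsClopen.eq_univ ⟨hclosed, hopen⟩ (Set.range_nonempty f))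

/-- Unique solvability of the implicit equation, with continuous dependence on the data. -/
theorem exists_implicit_solution [FiniteDimensional ℂ E] {τ : ℝ} (hτ : 0 < τ) (hτ1 : τ ≤ 1)
    {X : E → E → E} (hX : ContDiff ℝ 1 (fun p : E × E => X p.1 p.2))
    (him : ∀ w u, (inner ℂ u (X w u)).im = 0)
    (hd : ∀ w u v, ‖u - v‖ ^ 2 ≤ |(inner ℂ (u - v) (X w u - X w v)).re| ∨
      τ * ‖X w u - X w v‖ ≤ ‖u - v‖ / 2) :
    ∃ Ψ : E × E → E, Continuous Ψ ∧
      ∀ w y u, implicitMap τ (X w) u = y ↔ u = Ψ (w, y) := by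
  have hfin : FiniteDimensional ℝ E := FiniteDimensional.complexToReal E
  have : ProperSpace E := FiniteDimensional.proper ℂ E
  have hI : ContDiff ℝ 1 (fun p : E × E => implicitMap τ (X p.1) p.2) := by
    unfold implicitMap
    refine contDiff_snd.sub ?_
    exact contDiff_const.smul (contDiff_const.smul hX)
  have hanti w u v := norm_sub_le_implicitMap hτ hτ1 (hd w u v)
  -- Carrying the parameter `w` along makes the solution jointly continuous: `Θ` is a proper
  -- continuous bijection, hence a homeomorphism.
  let Θ : E × E → E × E := fun p => (p.1, implicitMap τ (X p.1) p.2)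
  have hΘc : Continuous Θ := continuous_fst.prodMk hI.continuous
  have hΘp : IsProperMap Θ := isProperMap_iff_tendsto_cocompact.2 ⟨hΘc, by
    rw [← Metric.cobounded_eq_cocompact, ← tendsto_norm_atTop_iff_cobounded]
    refine Filter.tendsto_atTop_mono (fun p => ?_) tendsto_norm_cobounded_atTop
    exact max_le_max le_rfl (norm_le_norm_implicitMap (him _ _))⟩
  have hinj : Function.Injective Θ := by
    rintro ⟨w, u⟩ ⟨w', v⟩ h
    simp only [Θ, Prod.mk.injEq] at h
    obtain ⟨rfl, h⟩ := h
    have := hanti w u v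
    rw [h, sub_self, norm_zero, mul_zero, norm_le_zero_iff, sub_eq_zero] at this
    rw [this]
  have hsurj : Function.Surjective Θ := by
    rintro ⟨w, y⟩
    have hc : ContDiff ℝ 1 (implicitMap τ (X w)) :=
      hI.comp (contDiff_const.prodMk contDiff_id : ContDiff ℝ 1 fun u : E => (w, u))
    obtain ⟨u, hu⟩ := surjective_of_contDiff_of_norm_sub_le hc (hanti w)
      (fun u => norm_le_norm_implicitMap (him w u)) y
    exact ⟨(w, u), by simp [Θ, hu]⟩
  let e := (Equiv.ofBijective Θ ⟨hinj, hsurj⟩).toHomeomorphOfContinuousClosed hΘc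
    hΘp.isClosedMap
  refine ⟨fun p => (e.symm p).2, continuous_snd.comp e.symm.continuous, fun w y u => ?_⟩
  have hfst : (e.symm (w, y)).1 = w := by
    have : e (e.symm (w, y)) = (w, y) := e.apply_symm_apply _
    exact congrArg Prod.fst this
  constructor
  · rintro rfl
    have : e.symm (e (w, u)) = (w, u) := e.symm_apply_apply _
    exact (congrArg Prod.snd this).symm
  · rintro rfl
    have : e (e.symm (w, y)) = (w, y) := e.apply_symm_apply _
    have h2 : implicitMap τ (X (e.symm (w, y)).1) (e.symm (w, y)).2 = y := congrArg Prod.snd this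
    rwa [hfst] at h2

end ImplicitSolver

/-! ### Sine modes, the spaces `V N` and the Laplacian on them. -/

section Modes

lemma continuous_eFun (m : ℕ) : Continuous (eFun m) := by unfold eFun; fun_prop

lemma norm_eFun_le (m : ℕ) (x : ℝ) : ‖eFun m x‖ ≤ 2 := by
  rw [eFun, Complex.norm_real, norm_mul, Real.norm_of_nonneg (Real.sqrt_nonneg 2)]
  have h1 : Real.sqrt 2 ≤ 2 := by rw [Real.sqrt_le_left (by norm_num)]; norm_num
  have h2 := Real.abs_sin_le_one (((m : ℝ) + 1) * Real.pi * x)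
  rw [Real.norm_eq_abs]
  nlinarith [abs_nonneg (Real.sin (((m : ℝ) + 1) * Real.pi * x)), Real.sqrt_nonneg 2]

lemma conj_eFun (m : ℕ) (x : ℝ) : (starRingEnd ℂ) (eFun m x) = eFun m x := Complex.conj_ofReal _

lemma integral_cos_int_mul_pi {k : ℤ} (hk : k ≠ 0) :
    ∫ x in (0 : ℝ)..1, Real.cos ((k : ℝ) * Real.pi * x) = 0 := by
  have hk' : (k : ℝ) * Real.pi ≠ 0 := mul_ne_zero (Int.cast_ne_zero.2 hk) Real.pi_ne_zero
  rw [intervalIntegral.integral_comp_mul_left (fun x => Real.cos x) hk']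
  simp [Real.sin_int_mul_pi]

lemma integral_eFun_mul_eFun (m n : ℕ) :
    ∫ x in Set.Ioo (0 : ℝ) 1, eFun m x * eFun n x = if m = n then 1 else 0 := by
  have h1 : ∀ x, eFun m x * eFun n x =
      ((Real.cos ((((m : ℤ) - n : ℤ) : ℝ) * Real.pi * x) -
        Real.cos ((((m : ℤ) + n + 2 : ℤ) : ℝ) * Real.pi * x) : ℝ) : ℂ) := by
    intro x
    have h2 := Real.two_mul_sin_mul_sin (((m : ℝ) + 1) * Real.pi * x) (((n : ℝ) + 1) * Real.pi * x)
    have h3 : Real.sqrt 2 * Real.sqrt 2 = 2 := Real.mul_self_sqrt (by norm_num)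
    rw [eFun, eFun, ← Complex.ofReal_mul]
    congr 1
    have e1 : (((m : ℤ) - n : ℤ) : ℝ) * Real.pi * x =
      ((m : ℝ) + 1) * Real.pi * x - ((n : ℝ) + 1) * Real.pi * x := by push_cast; ring
    have e2 : (((m : ℤ) + n + 2 : ℤ) : ℝ) * Real.pi * x =
      ((m : ℝ) + 1) * Real.pi * x + ((n : ℝ) + 1) * Real.pi * x := by push_cast; ring
    rw [e1, e2, ← h2]
    linear_combination Real.sin (((m : ℝ) + 1) * Real.pi * x) *
      Real.sin (((n : ℝ) + 1) * Real.pi * x) * h3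
  simp_rw [h1]
  rw [integral_complex_ofReal, ← integral_Ioc_eq_integral_Ioo,
    ← intervalIntegral.integral_of_le zero_le_one, intervalIntegral.integral_sub
      (Continuous.intervalIntegrable (by fun_prop) _ _)
      (Continuous.intervalIntegrable (by fun_prop) _ _),
    integral_cos_int_mul_pi (k := (m : ℤ) + n + 2) (by omega)]
  split_ifs with h
  · subst h; simp
  · rw [integral_cos_int_mul_pi (by omega)]; simp

lemma coeFn_e (m : ℕ) : e m =ᵐ[volume.restrict (Set.Ioo (0 : ℝ) 1)] eFun m :=
  (memLp_eFun m).coeFn_toLp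

lemma inner_e (m : ℕ) (u : L2) : inner ℂ (e m) u = coeff u m := by
  rw [L2.inner_def, coeff]
  refine integral_congr_ae ?_
  filter_upwards [coeFn_e m] with x hx
  rw [hx, RCLike.inner_apply]

lemma coeff_congr {f g : ℝ → ℂ} (h : f =ᵐ[volume.restrict (Set.Ioo (0 : ℝ) 1)] g) (m : ℕ) :
    coeff f m = coeff g m := by
  refine integral_congr_ae ?_
  filter_upwards [h] with x hx
  rw [hx]

lemma proj_congr {f g : ℝ → ℂ} (h : f =ᵐ[volume.restrict (Set.Ioo (0 : ℝ) 1)] g) (N : ℕ) :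
    proj N f = proj N g := by
  simp_rw [proj, coeff_congr h]

lemma orthonormal_e : Orthonormal ℂ e := by
  rw [orthonormal_iff_ite]
  intro i j
  rw [inner_e, coeff_congr (coeFn_e j), coeff]
  simp_rw [conj_eFun]
  rw [integral_eFun_mul_eFun]
  simp [eq_comm]

lemma e_mem_V {N m : ℕ} (h : m < N) : e m ∈ V N :=
  Submodule.subset_span ⟨m, h, rfl⟩

lemma sum_smul_e_mem_V (N : ℕ) (c : ℕ → ℂ) : ∑ m ∈ Finset.range N, c m • e m ∈ V N :=
  Submodule.sum_mem _ fun _ hm => Submodule.smul_mem _ _ (e_mem_V (Finset.mem_range.1 hm))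

lemma proj_mem_V (N : ℕ) (f : ℝ → ℂ) : proj N f ∈ V N := sum_smul_e_mem_V N _

instance finiteDimensional_V (N : ℕ) : FiniteDimensional ℂ (V N) :=
  FiniteDimensional.span_of_finite ℂ ((Set.finite_lt_nat N).image e)

lemma coeff_eq_zero_of_mem_V {N : ℕ} {u : L2} (hu : u ∈ V N) {m : ℕ} (hm : N ≤ m) :
    coeff u m = 0 := by
  rw [← inner_e]
  induction hu using Submodule.span_induction with
  | mem x hx =>
    obtain ⟨n, hn, rfl⟩ := hx
    exact orthonormal_e.2 (by simp only [Set.mem_ofPred_eq] at hn; omega)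
  | zero => simp
  | add x y _ _ hx hy => rw [inner_add_right, hx, hy, add_zero]
  | smul a x _ hx => rw [inner_smul_right, hx, mul_zero]

lemma inner_e_sum (N : ℕ) (c : ℕ → ℂ) (m : ℕ) :
    inner ℂ (e m) (∑ n ∈ Finset.range N, c n • e n) = if m < N then c m else 0 := by
  simp_rw [inner_sum, inner_smul_right, orthonormal_iff_ite.1 orthonormal_e]
  simp

lemma sum_coeff_smul_e {N : ℕ} {u : L2} (hu : u ∈ V N) :
    ∑ m ∈ Finset.range N, coeff u m • e m = u := by
  simp_rw [← inner_e]
  induction hu using Submodule.span_induction with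
  | mem x hx =>
    obtain ⟨n, hn, rfl⟩ := hx
    simp_rw [orthonormal_iff_ite.1 orthonormal_e]
    simp only [ite_smul, one_smul, zero_smul, Finset.sum_ite_eq', Finset.mem_range]
    exact if_pos hn
  | zero => simp
  | add x y _ _ hx hy =>
    simp_rw [inner_add_right, add_smul, Finset.sum_add_distrib]; rw [hx, hy]
  | smul a x _ hx =>
    simp_rw [inner_smul_right, mul_smul, ← Finset.smul_sum]; rw [hx]

lemma inner_sum_smul_e (N : ℕ) (u : L2) (c : ℕ → ℂ) :
    inner ℂ u (∑ m ∈ Finset.range N, c m • e m) =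
      ∑ m ∈ Finset.range N, c m * (starRingEnd ℂ) (coeff u m) := by
  simp_rw [inner_sum, inner_smul_right, ← inner_e, inner_conj_symm]

lemma norm_sq_eq_sum {N : ℕ} {u : L2} (hu : u ∈ V N) :
    ‖u‖ ^ 2 = ∑ m ∈ Finset.range N, ‖coeff u m‖ ^ 2 := by
  have h : inner ℂ u u = ∑ m ∈ Finset.range N, coeff u m * (starRingEnd ℂ) (coeff u m) := by
    rw [← inner_sum_smul_e, sum_coeff_smul_e hu]
  rw [inner_self_eq_norm_sq_to_K] at h
  simp_rw [Complex.mul_conj, Complex.normSq_eq_norm_sq] at h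
  simpa [← Complex.ofReal_pow] using congrArg Complex.re h

lemma norm_coeff_le (u : L2) (m : ℕ) : ‖coeff u m‖ ≤ ‖u‖ := by
  rw [← inner_e]
  simpa [orthonormal_e.1 m] using norm_inner_le_norm (𝕜 := ℂ) (e m) u

lemma laplacian_eq_sum {N : ℕ} {u : L2} (hu : u ∈ V N) :
    laplacian u = ∑ m ∈ Finset.range N,
      (-((((m : ℝ) + 1) * Real.pi) ^ 2 : ℝ) * coeff u m : ℂ) • e m := by
  refine tsum_eq_sum fun m hm => ?_
  rw [coeff_eq_zero_of_mem_V hu (by simpa using hm), mul_zero, zero_smul]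

lemma laplacian_mem_V {N : ℕ} {u : L2} (hu : u ∈ V N) : laplacian u ∈ V N := by
  rw [laplacian_eq_sum hu]; exact sum_smul_e_mem_V N _

lemma inner_laplacian {N : ℕ} {u : L2} (hu : u ∈ V N) :
    inner ℂ u (laplacian u) =
      ((-∑ m ∈ Finset.range N, (((m : ℝ) + 1) * Real.pi) ^ 2 * ‖coeff u m‖ ^ 2 : ℝ) : ℂ) := by
  rw [laplacian_eq_sum hu, inner_sum_smul_e, ← Finset.sum_neg_distrib, Complex.ofReal_sum]
  refine Finset.sum_congr rfl fun m _ => ?_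
  rw [mul_assoc, Complex.mul_conj, Complex.normSq_eq_norm_sq]
  push_cast; ring

lemma laplacian_sub {N : ℕ} {u v : L2} (hu : u ∈ V N) (hv : v ∈ V N) :
    laplacian (u - v) = laplacian u - laplacian v := by
  rw [laplacian_eq_sum hu, laplacian_eq_sum hv, laplacian_eq_sum (sub_mem hu hv),
    ← Finset.sum_sub_distrib]
  refine Finset.sum_congr rfl fun m _ => ?_
  rw [← inner_e, ← inner_e, ← inner_e, inner_sub_right, ← sub_smul]
  ring_nf

/-- All eigenvalues `((m+1)π)²` are at least 1. This coercivity settles `λ ≤ 0`. -/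
lemma norm_sq_le_neg_inner_laplacian {N : ℕ} {u : L2} (hu : u ∈ V N) :
    ‖u‖ ^ 2 ≤ -(inner ℂ u (laplacian u)).re := by
  rw [inner_laplacian hu, Complex.ofReal_re, neg_neg, norm_sq_eq_sum hu]
  refine Finset.sum_le_sum fun m _ => le_mul_of_one_le_left (by positivity) ?_
  have h1 : (1 : ℝ) ≤ ((m : ℝ) + 1) * Real.pi := by
    nlinarith [Real.pi_gt_three, (Nat.cast_nonneg m : (0 : ℝ) ≤ m)]
  nlinarith

lemma sq_mode_le {N m : ℕ} (hm : m < N) :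
    (((m : ℝ) + 1) * Real.pi) ^ 2 ≤ ((N : ℝ) * Real.pi) ^ 2 := by
  have : (m : ℝ) + 1 ≤ N := by exact_mod_cast hm
  gcongr

lemma norm_laplacian_le {N : ℕ} {u : L2} (hu : u ∈ V N) :
    ‖laplacian u‖ ≤ ((N : ℝ) * Real.pi) ^ 2 * ‖u‖ := by
  refine le_of_sq_le_sq ?_ (by positivity)
  rw [norm_sq_eq_sum (laplacian_mem_V hu), mul_pow, norm_sq_eq_sum hu, Finset.mul_sum]
  refine Finset.sum_le_sum fun m hm => ?_
  have hm' := Finset.mem_range.1 hm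
  rw [← inner_e, laplacian_eq_sum hu, inner_e_sum, if_pos hm', norm_mul, mul_pow]
  refine mul_le_mul_of_nonneg_right ?_ (by positivity)
  have h2 : ‖(-((((m : ℝ) + 1) * Real.pi) ^ 2 : ℝ) : ℂ)‖ = (((m : ℝ) + 1) * Real.pi) ^ 2 := by
    rw [norm_neg, Complex.norm_real, Real.norm_of_nonneg (by positivity)]
  rw [h2]
  exact pow_le_pow_left₀ (by positivity) (sq_mode_le hm') 2

end Modes

/-! ### Lipschitz and monotonicity estimates for the cubic term. -/

section Nonlinearity

/-- The continuous representative of an element of `V N`. -/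
noncomputable def ev (N : ℕ) (u : L2) (x : ℝ) : ℂ :=
  ∑ m ∈ Finset.range N, coeff u m * eFun m x

/-- The nonlinearity `(|u|² + |w|²)/2 · u`. -/
noncomputable def cubic (N : ℕ) (w u : L2) (x : ℝ) : ℂ :=
  (((‖ev N u x‖ ^ 2 + ‖ev N w x‖ ^ 2) / 2 : ℝ) : ℂ) * ev N u x

lemma continuous_ev (N : ℕ) (u : L2) : Continuous (ev N u) :=
  continuous_finsetSum _ fun m _ => continuous_const.mul (continuous_eFun m)

lemma continuous_cubic (N : ℕ) (w u : L2) : Continuous (cubic N w u) := by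
  have h1 := continuous_ev N u
  have h2 := continuous_ev N w
  unfold cubic; fun_prop

lemma ev_sub (N : ℕ) (u v : L2) (x : ℝ) : ev N (u - v) x = ev N u x - ev N v x := by
  simp_rw [ev, ← inner_e, inner_sub_right, sub_mul, Finset.sum_sub_distrib]

lemma ev_smul (N : ℕ) (a : ℂ) (u : L2) (x : ℝ) : ev N (a • u) x = a * ev N u x := by
  simp_rw [ev, ← inner_e, inner_smul_right, Finset.mul_sum, mul_assoc]

lemma norm_ev_le (N : ℕ) (u : L2) (x : ℝ) : ‖ev N u x‖ ≤ 2 * N * ‖u‖ := by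
  calc ‖ev N u x‖ ≤ ∑ m ∈ Finset.range N, ‖u‖ * 2 := norm_sum_le_of_le _ fun m _ => by
        rw [norm_mul]
        exact mul_le_mul (norm_coeff_le u m) (norm_eFun_le m x) (norm_nonneg _) (norm_nonneg _)
    _ = 2 * N * ‖u‖ := by simp; ring

/-- Replaces almost-everywhere classes by trigonometric polynomials, for which pointwise bounds,
continuity and analyticity are available. -/
lemma coeFn_ae_eq_ev {N : ℕ} {u : L2} (hu : u ∈ V N) :
    u =ᵐ[volume.restrict (Set.Ioo (0 : ℝ) 1)] ev N u := by
  have h : ∀ s : Finset ℕ, (∑ m ∈ s, coeff u m • e m : L2)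
      =ᵐ[volume.restrict (Set.Ioo (0 : ℝ) 1)] fun x => ∑ m ∈ s, coeff u m * eFun m x := by
    intro s
    induction s using Finset.cons_induction with
    | empty =>
      simp_rw [Finset.sum_empty]
      exact Lp.coeFn_zero ℂ 2 (volume.restrict (Set.Ioo (0 : ℝ) 1))
    | cons a s ha ih =>
      simp_rw [Finset.sum_cons]
      filter_upwards [Lp.coeFn_add (coeff u a • e a) (∑ m ∈ s, coeff u m • e m), ih,
        Lp.coeFn_smul (coeff u a) (e a), coeFn_e a] with x h1 h2 h3 h4
      rw [h1, Pi.add_apply, h2, h3, Pi.smul_apply, h4, smul_eq_mul]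
  have h2 := h (Finset.range N)
  rw [sum_coeff_smul_e hu] at h2
  exact h2

lemma integrableOn_of_continuous {F : Type*} [NormedAddCommGroup F] {f : ℝ → F}
    (hf : Continuous f) : IntegrableOn f (Set.Ioo (0 : ℝ) 1) :=
  (hf.integrableOn_Icc (a := 0) (b := 1)).mono_set Set.Ioo_subset_Icc_self

lemma coeff_sub {f g : ℝ → ℂ} (hf : Continuous f) (hg : Continuous g) (m : ℕ) :
    coeff (fun x => f x - g x) m = coeff f m - coeff g m := by
  unfold coeff
  have hm := continuous_eFun m
  rw [← integral_sub (integrableOn_of_continuous (by fun_prop))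
    (integrableOn_of_continuous (by fun_prop))]
  simp_rw [sub_mul]

lemma proj_sub {f g : ℝ → ℂ} (hf : Continuous f) (hg : Continuous g) (N : ℕ) :
    proj N (fun x => f x - g x) = proj N f - proj N g := by
  simp_rw [proj, coeff_sub hf hg, sub_smul, Finset.sum_sub_distrib]

lemma inner_proj (N : ℕ) (u : L2) {f : ℝ → ℂ} (hf : Continuous f) :
    inner ℂ u (proj N f) = ∫ x in Set.Ioo (0 : ℝ) 1, f x * (starRingEnd ℂ) (ev N u x) := by
  rw [proj, inner_sum_smul_e]
  simp_rw [ev, map_sum, Finset.mul_sum]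
  rw [integral_finsetSum _ fun m _ => integrableOn_of_continuous (by
    have := continuous_eFun m; fun_prop)]
  refine Finset.sum_congr rfl fun m _ => ?_
  rw [coeff, ← integral_mul_const]
  refine integral_congr_ae (Filter.Eventually.of_forall fun x => ?_)
  simp only [map_mul]; ring

lemma norm_setIntegral_Ioo_le {f : ℝ → ℂ} {B : ℝ} (hf : ∀ x, ‖f x‖ ≤ B) :
    ‖∫ x in Set.Ioo (0 : ℝ) 1, f x‖ ≤ B := by
  simpa using norm_integral_le_of_norm_le_const (μ := volume.restrict (Set.Ioo (0 : ℝ) 1))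
    (Filter.Eventually.of_forall hf)

lemma norm_proj_le (N : ℕ) {f : ℝ → ℂ} {B : ℝ} (hf : ∀ x, ‖f x‖ ≤ B) :
    ‖proj N f‖ ≤ 2 * N * B := by
  calc ‖proj N f‖ ≤ ∑ m ∈ Finset.range N, B * 2 := norm_sum_le_of_le _ fun m _ => by
        rw [norm_smul, orthonormal_e.1 m, mul_one, coeff]
        refine norm_setIntegral_Ioo_le fun x => ?_
        rw [norm_mul, RCLike.norm_conj]
        exact mul_le_mul (hf x) (norm_eFun_le m x) (norm_nonneg _) ((norm_nonneg _).trans (hf x))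
    _ = 2 * N * B := by simp; ring

lemma norm_cubic_sub_le_aux (s : ℝ) (hs : 0 ≤ s) (a b : ℂ) :
    ‖(((‖a‖ ^ 2 + s) / 2 : ℝ) : ℂ) * a - (((‖b‖ ^ 2 + s) / 2 : ℝ) : ℂ) * b‖ ≤
      (‖a‖ ^ 2 + ‖b‖ ^ 2 + s) * ‖a - b‖ := by
  have h1 : (((‖a‖ ^ 2 + s) / 2 : ℝ) : ℂ) * a - (((‖b‖ ^ 2 + s) / 2 : ℝ) : ℂ) * b =
      (((‖a‖ ^ 2 + s) / 2 : ℝ) : ℂ) * (a - b) + (((‖a‖ ^ 2 - ‖b‖ ^ 2) / 2 : ℝ) : ℂ) * b := by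
    push_cast; ring
  have h2 : ‖a‖ - ‖b‖ ≤ ‖a - b‖ := norm_sub_norm_le a b
  have h3 : ‖b‖ - ‖a‖ ≤ ‖a - b‖ := by rw [norm_sub_rev]; exact norm_sub_norm_le b a
  have ha := norm_nonneg a
  have hb := norm_nonneg b
  have h4 : |(‖a‖ ^ 2 - ‖b‖ ^ 2) / 2| ≤ ‖a - b‖ * ((‖a‖ + ‖b‖) / 2) := by
    rw [abs_le]; constructor <;> nlinarith
  rw [h1]
  refine (norm_add_le _ _).trans ?_
  rw [norm_mul, norm_mul, Complex.norm_real, Complex.norm_real, Real.norm_eq_abs, Real.norm_eq_abs,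
    abs_of_nonneg (by positivity : (0 : ℝ) ≤ (‖a‖ ^ 2 + s) / 2)]
  have h5 : |(‖a‖ ^ 2 - ‖b‖ ^ 2) / 2| * ‖b‖ ≤ ‖a - b‖ * ((‖a‖ + ‖b‖) / 2) * ‖b‖ := by gcongr
  have h6 : (‖a‖ + ‖b‖) / 2 * ‖b‖ ≤ ‖a‖ ^ 2 / 2 + ‖b‖ ^ 2 := by nlinarith [sq_nonneg (‖a‖ - ‖b‖)]
  nlinarith [norm_nonneg (a - b), mul_le_mul_of_nonneg_left h6 (norm_nonneg (a - b)),
    mul_nonneg hs (norm_nonneg (a - b))]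

/-- The two sides differ by the square `(|a|² - |b|²)²/4`. -/
lemma re_cubic_sub_mul_conj_aux (s : ℝ) (a b : ℂ) :
    (‖a‖ ^ 2 + ‖b‖ ^ 2 + s) / 4 * ‖a - b‖ ^ 2 + s / 4 * ‖a - b‖ ^ 2 ≤
      (((((‖a‖ ^ 2 + s) / 2 : ℝ) : ℂ) * a - (((‖b‖ ^ 2 + s) / 2 : ℝ) : ℂ) * b) *
        (starRingEnd ℂ) (a - b)).re := by
  simp only [← Complex.normSq_eq_norm_sq, Complex.normSq_apply, Complex.mul_re, Complex.sub_re,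
    Complex.sub_im, Complex.mul_im, Complex.ofReal_re, Complex.ofReal_im, Complex.conj_re,
    Complex.conj_im]
  nlinarith [sq_nonneg (a.re * a.re + a.im * a.im - (b.re * b.re + b.im * b.im))]

/-- If the integral vanished, the product of the two analytic functions would vanish on the
interval, hence so would one factor. -/
lemma integral_normSq_ev_pos {N : ℕ} {u h : L2} (hu : u ∈ V N) (hh : h ∈ V N) (hu0 : u ≠ 0)
    (hh0 : h ≠ 0) : 0 < ∫ x in Set.Ioo (0 : ℝ) 1, ‖ev N u x‖ ^ 2 * ‖ev N h x‖ ^ 2 := by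
  have hcu := continuous_ev N u
  have hch := continuous_ev N h
  have hnn : ∀ x, 0 ≤ ‖ev N u x‖ ^ 2 * ‖ev N h x‖ ^ 2 := fun x => by positivity
  refine (integral_nonneg hnn).lt_of_ne' fun h0 => ?_
  rw [integral_eq_zero_iff_of_nonneg hnn (integrableOn_of_continuous (by fun_prop))] at h0
  have heq : Set.EqOn (fun x => ‖ev N u x‖ ^ 2 * ‖ev N h x‖ ^ 2) 0 (Set.Ioo 0 1) :=
    Measure.eqOn_open_of_ae_eq h0 isOpen_Ioo (by fun_prop) continuousOn_const
  have hzero : ∀ v : L2, v ∈ V N → (∀ x ∈ Set.Ioo (0 : ℝ) 1, ev N v x = 0) → v = 0 := by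
    intro v hv h1
    rw [Lp.eq_zero_iff_ae_eq_zero]
    filter_upwards [coeFn_ae_eq_ev hv, ae_restrict_mem measurableSet_Ioo] with x h2 h3
    rw [h2, h1 x h3]; rfl
  have han : ∀ v : L2, AnalyticOnNhd ℝ (ev N v) (Set.Ioo 0 1) := by
    intro v x _
    refine Finset.analyticAt_fun_sum _ fun m _ => analyticAt_const.mul ?_
    exact (Complex.ofRealCLM.analyticAt _).comp (analyticAt_const.mul
      (Real.analyticAt_sin.comp (analyticAt_const.mul analyticAt_id)))
  rcases AnalyticOnNhd.eq_zero_or_eq_zero_of_mul_eq_zero (han u) (han h)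
    (fun x hx => by simpa using heq hx) isPreconnected_Ioo with h1 | h1
  · exact hu0 (hzero u hu h1)
  · exact hh0 (hzero h hh h1)

lemma continuous_integral_normSq_ev (N : ℕ) : Continuous fun p : V N × V N =>
    ∫ x in Set.Ioo (0 : ℝ) 1, ‖ev N p.1 x‖ ^ 2 * ‖ev N p.2 x‖ ^ 2 := by
  simp_rw [← integral_Icc_eq_integral_Ioo]
  refine continuous_parametric_integral_of_continuous ?_ isCompact_Icc
  simp_rw [Function.uncurry_def, ev, ← inner_e]
  have := continuous_eFun
  fun_prop

/-- The integral attains a positive minimum on the compact product of unit spheres; homogeneity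
extends the bound to all vectors. -/
lemma exists_le_integral_normSq_ev (N : ℕ) : ∃ c : ℝ, 0 < c ∧ ∀ u h : V N,
    c * ‖u‖ ^ 2 * ‖h‖ ^ 2 ≤ ∫ x in Set.Ioo (0 : ℝ) 1, ‖ev N u x‖ ^ 2 * ‖ev N h x‖ ^ 2 := by
  have : ProperSpace (V N) := FiniteDimensional.proper ℂ _
  set Q : V N × V N → ℝ := fun p =>
    ∫ x in Set.Ioo (0 : ℝ) 1, ‖ev N p.1 x‖ ^ 2 * ‖ev N p.2 x‖ ^ 2 with hQ
  have hK : IsCompact (Metric.sphere (0 : V N) 1 ×ˢ Metric.sphere (0 : V N) 1) :=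
    (isCompact_sphere _ _).prod (isCompact_sphere _ _)
  obtain ⟨c, hc, hcQ⟩ : ∃ c : ℝ, 0 < c ∧
      ∀ p ∈ Metric.sphere (0 : V N) 1 ×ˢ Metric.sphere (0 : V N) 1, c ≤ Q p := by
    rcases (Metric.sphere (0 : V N) 1 ×ˢ Metric.sphere (0 : V N) 1).eq_empty_or_nonempty with h | h
    -- This covers `N = 0`, where the spheres are empty and any constant serves.
    · exact ⟨1, one_pos, fun p hp => by simp [h] at hp⟩
    · obtain ⟨p, hp, hmin⟩ := hK.exists_isMinOn h (continuous_integral_normSq_ev N).continuousOn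
      refine ⟨Q p, ?_, fun q hq => hmin hq⟩
      have h0 : ∀ v ∈ Metric.sphere (0 : V N) 1, (v : L2) ≠ 0 := by
        intro v hv h0
        rw [mem_sphere_zero_iff_norm, ZeroMemClass.coe_eq_zero.1 h0, norm_zero] at hv
        exact zero_ne_one hv
      exact integral_normSq_ev_pos p.1.2 p.2.2 (h0 _ hp.1) (h0 _ hp.2)
  have hscale : ∀ (a b : ℂ) (u h : V N), Q (a • u, b • h) = ‖a‖ ^ 2 * ‖b‖ ^ 2 * Q (u, h) := by
    intro a b u h
    simp only [hQ, Submodule.coe_smul, ev_smul, norm_mul]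
    rw [← integral_const_mul]
    congr 1; ext x; ring
  refine ⟨c, hc, fun u h => ?_⟩
  change _ ≤ Q (u, h)
  rcases eq_or_ne u 0 with rfl | hu
  · simp only [norm_zero, ne_eq, OfNat.ofNat_ne_zero, not_false_eq_true, zero_pow, mul_zero,
      zero_mul]
    exact integral_nonneg fun x => by positivity
  rcases eq_or_ne h 0 with rfl | hh
  · simp only [norm_zero, ne_eq, OfNat.ofNat_ne_zero, not_false_eq_true, zero_pow, mul_zero]
    exact integral_nonneg fun x => by positivity
  have hu' := norm_pos_iff.2 hu
  have hh' := norm_pos_iff.2 hh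
  have hn : ∀ v : V N, v ≠ 0 → ((‖v‖⁻¹ : ℝ) : ℂ) • v ∈ Metric.sphere (0 : V N) 1 := by
    intro v hv
    rw [mem_sphere_zero_iff_norm, norm_smul, Complex.norm_real, norm_inv, norm_norm,
      inv_mul_cancel₀ (norm_ne_zero_iff.2 hv)]
  have := hcQ (_, _) ⟨hn u hu, hn h hh⟩
  rw [hscale, Complex.norm_real, Complex.norm_real, norm_inv, norm_inv, norm_norm, norm_norm] at this
  calc c * ‖u‖ ^ 2 * ‖h‖ ^ 2
      ≤ (‖u‖⁻¹ ^ 2 * ‖h‖⁻¹ ^ 2 * Q (u, h)) * ‖u‖ ^ 2 * ‖h‖ ^ 2 := by gcongr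
    _ = Q (u, h) := by field_simp

end Nonlinearity

/-! ### The drift: dichotomy, smoothness and the solution map. -/

section Drift

/-- The drift `Δu + λπ_N((|u|² + |w|²)/2 · u)` on `V N`. -/
noncomputable def drift (N : ℕ) (lam : ℝ) (w u : V N) : V N :=
  ⟨laplacian u + (lam : ℂ) • proj N (cubic N w u),
    add_mem (laplacian_mem_V u.2) (Submodule.smul_mem _ _ (proj_mem_V N _))⟩

lemma coe_drift (N : ℕ) (lam : ℝ) (w u : V N) :
    (drift N lam w u : L2) = laplacian u + (lam : ℂ) • proj N (cubic N w u) := rfl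

lemma im_inner_drift (N : ℕ) (lam : ℝ) (w u : V N) : (inner ℂ u (drift N lam w u)).im = 0 := by
  rw [Submodule.coe_inner, drift, inner_add_right, inner_smul_right, inner_laplacian u.2,
    inner_proj _ _ (continuous_cubic _ _ _)]
  have h : ∀ x, cubic N w u x * (starRingEnd ℂ) (ev N u x) =
      (((‖ev N u x‖ ^ 2 + ‖ev N w x‖ ^ 2) / 2 * ‖ev N u x‖ ^ 2 : ℝ) : ℂ) := by
    intro x
    rw [cubic, mul_assoc, Complex.mul_conj, Complex.normSq_eq_norm_sq]
    push_cast; ring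
  simp_rw [h]
  rw [integral_complex_ofReal, Complex.add_im, Complex.ofReal_im, ← Complex.ofReal_mul,
    Complex.ofReal_im, add_zero]

lemma drift_sub (N : ℕ) (lam : ℝ) (w u v : V N) :
    ((drift N lam w u - drift N lam w v : V N) : L2) = laplacian ((u - v : V N) : L2) +
      (lam : ℂ) • proj N (fun x => cubic N w u x - cubic N w v x) := by
  rw [Submodule.coe_sub, Submodule.coe_sub, laplacian_sub u.2 v.2,
    proj_sub (continuous_cubic _ _ _) (continuous_cubic _ _ _), drift, drift]
  simp only [smul_sub]; abel

lemma le_re_inner_proj_cubic_sub {N : ℕ} {c : ℝ} (hc : ∀ u h : V N,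
    c * ‖u‖ ^ 2 * ‖h‖ ^ 2 ≤ ∫ x in Set.Ioo (0 : ℝ) 1, ‖ev N u x‖ ^ 2 * ‖ev N h x‖ ^ 2)
    (w u v : V N) :
    c / 4 * (‖u‖ ^ 2 + ‖v‖ ^ 2 + ‖w‖ ^ 2) * ‖u - v‖ ^ 2 ≤
      (inner ℂ ((u - v : V N) : L2)
        (proj N (fun x => cubic N w u x - cubic N w v x))).re := by
  have hcu := continuous_ev N u
  have hcv := continuous_ev N v
  have hcw := continuous_ev N w
  have hcd := continuous_ev N ((u - v : V N) : L2)
  have hf : Continuous fun x => cubic N w u x - cubic N w v x :=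
    (continuous_cubic _ _ _).sub (continuous_cubic _ _ _)
  have hg : Continuous fun x => (cubic N w u x - cubic N w v x) *
      (starRingEnd ℂ) (ev N ((u - v : V N) : L2) x) := by fun_prop
  rw [inner_proj _ _ hf]
  have hre := integral_re (𝕜 := ℂ) (integrableOn_of_continuous hg)
  simp only [RCLike.re_eq_complex_re] at hre
  rw [← hre]
  have h1 : ∫ x in Set.Ioo (0 : ℝ) 1, (‖ev N u x‖ ^ 2 * ‖ev N ((u - v : V N) : L2) x‖ ^ 2 +
      ‖ev N v x‖ ^ 2 * ‖ev N ((u - v : V N) : L2) x‖ ^ 2 +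
      ‖ev N w x‖ ^ 2 * ‖ev N ((u - v : V N) : L2) x‖ ^ 2) / 4 ≤
      ∫ x in Set.Ioo (0 : ℝ) 1, ((cubic N w u x - cubic N w v x) *
      (starRingEnd ℂ) (ev N ((u - v : V N) : L2) x)).re := by
    refine integral_mono (integrableOn_of_continuous (by fun_prop))
      (integrableOn_of_continuous (Complex.continuous_re.comp hg)) fun x => ?_
    have := re_cubic_sub_mul_conj_aux (‖ev N w x‖ ^ 2) (ev N u x) (ev N v x)
    simp only [cubic, Submodule.coe_sub, ev_sub]
    nlinarith [mul_nonneg (sq_nonneg ‖ev N w x‖) (sq_nonneg ‖ev N u x - ev N v x‖)]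
  refine le_trans ?_ h1
  rw [integral_div, integral_add (integrableOn_of_continuous (by fun_prop))
    (integrableOn_of_continuous (by fun_prop)), integral_add
    (integrableOn_of_continuous (by fun_prop)) (integrableOn_of_continuous (by fun_prop))]
  linarith [hc u (u - v), hc v (u - v), hc w (u - v)]

lemma norm_proj_cubic_sub_le {N : ℕ} (w u v : V N) :
    ‖proj N (fun x => cubic N w u x - cubic N w v x)‖ ≤
      2 * N * (2 * N) ^ 3 * (‖u‖ ^ 2 + ‖v‖ ^ 2 + ‖w‖ ^ 2) * ‖u - v‖ := by
  have : ∀ x, ‖cubic N w u x - cubic N w v x‖ ≤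
      (2 * N) ^ 3 * (‖u‖ ^ 2 + ‖v‖ ^ 2 + ‖w‖ ^ 2) * ‖u - v‖ := by
    intro x
    refine (norm_cubic_sub_le_aux _ (sq_nonneg _) _ _).trans ?_
    rw [← ev_sub]
    have hu := pow_le_pow_left₀ (norm_nonneg _) (norm_ev_le N u x) 2
    have hv := pow_le_pow_left₀ (norm_nonneg _) (norm_ev_le N v x) 2
    have hw := pow_le_pow_left₀ (norm_nonneg _) (norm_ev_le N w x) 2
    have hd := norm_ev_le N ((u - v : V N) : L2) x
    calc _ ≤ ((2 * N * ‖(u : L2)‖) ^ 2 + (2 * N * ‖(v : L2)‖) ^ 2 + (2 * N * ‖(w : L2)‖) ^ 2) *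
          (2 * N * ‖((u - v : V N) : L2)‖) := by gcongr; exact hd
      _ = _ := by simp only [Submodule.coe_norm]; ring
  refine (norm_proj_le N this).trans_eq (by ring)

/-- For small time steps, depending only on `N`, the increments of the drift are coercive or
small. -/
lemma exists_drift_dichotomy (N : ℕ) : ∃ τ₁ : ℝ, 0 < τ₁ ∧ ∀ τ : ℝ, 0 < τ → τ ≤ τ₁ →
    ∀ lam : ℝ, (lam = -1 ∨ lam = 0 ∨ lam = 1) → ∀ w u v : V N,
      ‖u - v‖ ^ 2 ≤ |(inner ℂ (u - v) (drift N lam w u - drift N lam w v)).re| ∨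
        τ * ‖drift N lam w u - drift N lam w v‖ ≤ ‖u - v‖ / 2 := by
  obtain ⟨c, hc0, hc⟩ := exists_le_integral_normSq_ev N
  set Λ : ℝ := ((N : ℝ) * Real.pi) ^ 2 with hΛ
  set L : ℝ := 2 * N * (2 * N) ^ 3 with hL
  -- `B` is a Lipschitz constant of the drift for `λ = 1` while `ρ < 4(Λ+1)/c`. Beyond that
  -- threshold the cubic term contributes at least `(Λ+1)‖d‖²`, of which the Laplacian removes at
  -- most `Λ‖d‖²`.
  set B : ℝ := Λ + L * (4 * (Λ + 1) / c) with hB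
  have hΛ0 : 0 ≤ Λ := by positivity
  have hL0 : 0 ≤ L := by positivity
  have hB0 : 0 ≤ B := by positivity
  refine ⟨1 / (2 * (B + 1)), by positivity, fun τ hτ hτ1 lam hlam w u v => ?_⟩
  have h1 := le_re_inner_proj_cubic_sub hc w u v
  have h2 := norm_proj_cubic_sub_le w u v
  have hlap := norm_laplacian_le (u - v).2
  have hlap2 := norm_sq_le_neg_inner_laplacian (u - v).2
  set d := u - v with hd
  set G := proj N (fun x => cubic N w u x - cubic N w v x) with hG
  set ρ := ‖u‖ ^ 2 + ‖v‖ ^ 2 + ‖w‖ ^ 2 with hρ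
  have hρ0 : 0 ≤ ρ := by positivity
  have hinner : (inner ℂ d (drift N lam w u - drift N lam w v)).re =
      (inner ℂ (d : L2) (laplacian (d : L2))).re + lam * (inner ℂ (d : L2) G).re := by
    rw [Submodule.coe_inner, drift_sub, inner_add_right, inner_smul_right, Complex.add_re,
      Complex.re_ofReal_mul]
  have hdn : ‖d‖ = ‖(d : L2)‖ := rfl
  have hd0 := norm_nonneg d
  rw [← hdn] at hlap hlap2
  have hG0 : 0 ≤ (inner ℂ (d : L2) G).re := le_trans (by positivity) h1
  have hnonpos : lam ≤ 0 → ‖d‖ ^ 2 ≤ |(inner ℂ d (drift N lam w u - drift N lam w v)).re| := by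
    intro h
    rw [hinner]
    refine le_trans ?_ (neg_le_abs _)
    nlinarith
  rcases hlam with rfl | rfl | rfl
  · exact Or.inl (hnonpos (by norm_num))
  · exact Or.inl (hnonpos le_rfl)
  · rcases le_or_gt (4 * (Λ + 1) / c) ρ with h | h
    · left
      rw [hinner]
      refine le_trans ?_ (le_abs_self _)
      have h3 : Λ + 1 ≤ c / 4 * ρ := by
        rw [div_le_iff₀ hc0] at h; linarith
      have h4 : |(inner ℂ (d : L2) (laplacian (d : L2))).re| ≤ ‖d‖ * (Λ * ‖d‖) :=
        ((Complex.abs_re_le_norm _).trans (norm_inner_le_norm _ _)).trans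
          (mul_le_mul_of_nonneg_left hlap hd0)
      have h5 := neg_le_of_abs_le h4
      nlinarith [mul_le_mul_of_nonneg_right h3 (sq_nonneg ‖d‖)]
    · right
      have h3 : ‖drift N 1 w u - drift N 1 w v‖ ≤ B * ‖d‖ := by
        rw [Submodule.coe_norm, drift_sub, Complex.ofReal_one, one_smul]
        refine (norm_add_le _ _).trans ?_
        have h6 : L * ρ * ‖d‖ ≤ L * (4 * (Λ + 1) / c) * ‖d‖ := by gcongr
        rw [hB, add_mul]
        exact add_le_add hlap (h2.trans h6)
      have h4 : τ * (2 * (B + 1)) ≤ 1 := by rwa [le_div_iff₀ (by positivity)] at hτ1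
      calc τ * ‖drift N 1 w u - drift N 1 w v‖ ≤ τ * (B * ‖d‖) := by gcongr
        _ ≤ ‖d‖ / 2 := by nlinarith [mul_nonneg hτ.le hd0]

/-- The drift is polynomial in the coefficients and their conjugates; conjugation is only
real-linear, hence smoothness over `ℝ`. -/
lemma contDiff_cubic_expansion {E : Type*} [NormedAddCommGroup E] [InnerProductSpace ℂ E] {N : ℕ}
    (s : Finset ℕ) (ℓ : ℕ → E →L[ℂ] ℂ) (b : Fin N → E) (κ : ℕ → ℕ → ℕ → ℕ → ℂ) (a : ℕ → ℂ)
    (lam : ℂ) :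
    ContDiff ℝ 1 fun p : E × E => ∑ m : Fin N, (a m * ℓ m p.2 + lam *
      (((∑ i ∈ s, ∑ j ∈ s, ∑ k ∈ s,
        ℓ i p.2 * (starRingEnd ℂ) (ℓ k p.2) * ℓ j p.2 * κ i j k m) +
      ∑ i ∈ s, ∑ j ∈ s, ∑ k ∈ s,
        ℓ i p.1 * (starRingEnd ℂ) (ℓ k p.1) * ℓ j p.2 * κ i j k m) / 2)) • b m := by
  have h1 : ∀ i, ContDiff ℝ 1 fun p : E × E => ℓ i p.1 := fun i =>
    ((ℓ i).restrictScalars ℝ).contDiff.comp contDiff_fst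
  have h2 : ∀ i, ContDiff ℝ 1 fun p : E × E => ℓ i p.2 := fun i =>
    ((ℓ i).restrictScalars ℝ).contDiff.comp contDiff_snd
  have h3 : ∀ i, ContDiff ℝ 1 fun p : E × E => (starRingEnd ℂ) (ℓ i p.1) := fun i =>
    Complex.conjCLE.contDiff.comp (h1 i)
  have h4 : ∀ i, ContDiff ℝ 1 fun p : E × E => (starRingEnd ℂ) (ℓ i p.2) := fun i =>
    Complex.conjCLE.contDiff.comp (h2 i)
  refine ContDiff.sum fun m _ => ContDiff.smul ?_ contDiff_const
  refine (contDiff_const.mul (h2 m)).add (contDiff_const.mul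
    (ContDiff.div_const (ContDiff.add ?_ ?_) 2)) <;>
  refine ContDiff.sum fun i _ => ContDiff.sum fun j _ => ContDiff.sum fun k _ => ?_
  · exact (((h2 i).mul (h4 k)).mul (h2 j)).mul contDiff_const
  · exact (((h1 i).mul (h3 k)).mul (h2 j)).mul contDiff_const

/-- The modes are real, so conjugation touches only the coefficients and the four-mode integrals are
constants. -/
lemma coeff_mul_expansion (N : ℕ) (w u : L2) (m : ℕ) :
    coeff (fun x => ev N w x * (starRingEnd ℂ) (ev N w x) * ev N u x) m =
      ∑ i ∈ Finset.range N, ∑ j ∈ Finset.range N, ∑ k ∈ Finset.range N,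
        coeff w i * (starRingEnd ℂ) (coeff w k) * coeff u j *
          ∫ x in Set.Ioo (0 : ℝ) 1, eFun i x * eFun k x * eFun j x * eFun m x := by
  have hc := continuous_eFun
  have hx : ∀ x, ev N w x * (starRingEnd ℂ) (ev N w x) * ev N u x * (starRingEnd ℂ) (eFun m x) =
      ∑ i ∈ Finset.range N, ∑ j ∈ Finset.range N, ∑ k ∈ Finset.range N,
        coeff w i * (starRingEnd ℂ) (coeff w k) * coeff u j *
          (eFun i x * eFun k x * eFun j x * eFun m x) := by
    intro x
    simp_rw [ev, map_sum, map_mul, conj_eFun, Finset.sum_mul_sum, Finset.sum_mul]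
    refine Finset.sum_congr rfl fun i _ => Finset.sum_congr rfl fun j _ =>
      Finset.sum_congr rfl fun k _ => ?_
    ring
  rw [coeff]
  simp_rw [hx]
  rw [integral_finsetSum _ fun i _ => integrableOn_of_continuous (by fun_prop)]
  refine Finset.sum_congr rfl fun i _ => ?_
  rw [integral_finsetSum _ fun i _ => integrableOn_of_continuous (by fun_prop)]
  refine Finset.sum_congr rfl fun j _ => ?_
  rw [integral_finsetSum _ fun i _ => integrableOn_of_continuous (by fun_prop)]
  exact Finset.sum_congr rfl fun k _ => integral_const_mul _ _

lemma coeff_cubic (N : ℕ) (w u : L2) (m : ℕ) : coeff (cubic N w u) m =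
    (coeff (fun x => ev N u x * (starRingEnd ℂ) (ev N u x) * ev N u x) m +
      coeff (fun x => ev N w x * (starRingEnd ℂ) (ev N w x) * ev N u x) m) / 2 := by
  have hu := continuous_ev N u
  have hw := continuous_ev N w
  have hc := continuous_eFun m
  unfold coeff
  rw [← integral_add (integrableOn_of_continuous (by fun_prop))
    (integrableOn_of_continuous (by fun_prop)), ← integral_div]
  congr 1; ext x
  beta_reduce
  rw [Complex.mul_conj (ev N u x), Complex.mul_conj (ev N w x), Complex.normSq_eq_norm_sq, Complex.normSq_eq_norm_sq,
    cubic]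
  push_cast; ring

/-- The functional `u ↦ (u, e_m)` on `V N`. -/
noncomputable def coeffCLM (N m : ℕ) : V N →L[ℂ] ℂ := (innerSL ℂ (e m)).comp (V N).subtypeL

lemma coeffCLM_apply (N m : ℕ) (u : V N) : coeffCLM N m u = coeff (u : L2) m := inner_e m u

lemma drift_eq_sum (N : ℕ) (lam : ℝ) (w u : V N) : drift N lam w u = ∑ m : Fin N,
    ((-((((m : ℕ) : ℝ) + 1) * Real.pi) ^ 2 : ℝ) * coeff (u : L2) m +
      (lam : ℂ) * coeff (cubic N w u) m) • (⟨e m, e_mem_V m.2⟩ : V N) := by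
  refine Subtype.ext ?_
  rw [AddSubmonoidClass.coe_finsetSum, coe_drift, laplacian_eq_sum u.2, proj, Finset.smul_sum,
    ← Finset.sum_add_distrib, Finset.sum_range]
  refine Finset.sum_congr rfl fun m _ => ?_
  rw [Submodule.coe_smul, add_smul, mul_smul (lam : ℂ), Complex.ofReal_neg]

lemma sub_eq_add_iff_sub_eq_add {G : Type*} [AddCommGroup G] (u a x g : G) :
    u - a = x + g ↔ u - x = a + g := by
  rw [sub_eq_iff_eq_add, sub_eq_iff_eq_add, add_right_comm, add_comm x a, add_right_comm]

/-- `e^{-ατ}v` enters twice: as part of the right-hand side and as the parameter `w` of the drift.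
-/
lemma step_iff {N : ℕ} {α lam : ℝ} {τ : ℝ≥0} (v u g : V N) :
    Step N α lam τ v u g ↔
      implicitMap τ (drift N lam ((Real.exp (-(α * τ)) : ℂ) • v)) u =
        (Real.exp (-(α * τ)) : ℂ) • v + g := by
  have hp : proj N (fun x => (((‖(u : L2) x‖ ^ 2 +
      ‖(Real.exp (-(α * τ)) : ℂ) * (v : L2) x‖ ^ 2) / 2 : ℝ) : ℂ) * (u : L2) x) =
      proj N (cubic N (((Real.exp (-(α * τ)) : ℂ) • v : V N) : L2) u) := by
    refine proj_congr ?_ N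
    filter_upwards [coeFn_ae_eq_ev u.2, coeFn_ae_eq_ev v.2] with x h1 h2
    rw [h1, h2, cubic, Submodule.coe_smul, ev_smul]
  rw [Step, implicitMap, ← (Subtype.coe_injective (p := (· ∈ V N))).eq_iff, hp,
    Submodule.coe_sub, Submodule.coe_smul, Submodule.coe_smul, Submodule.coe_smul, coe_drift, Submodule.coe_add,
    Submodule.coe_smul, sub_eq_add_iff_sub_eq_add, mul_smul Complex.I, ← smul_add Complex.I]

/-- For small time steps, depending only on `N`, the scheme has a continuous solution map. -/
theorem exists_solution_map (N : ℕ) : ∃ τ₁ : ℝ, 0 < τ₁ ∧ ∀ τ : ℝ≥0, 0 < τ → (τ : ℝ) ≤ τ₁ →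
    ∀ lam : ℝ, (lam = -1 ∨ lam = 0 ∨ lam = 1) → ∀ α : ℝ, ∃ Ψ : V N × V N → V N, Continuous Ψ ∧
      (∀ v g u : V N, Step N α lam τ v u g ↔ u = Ψ (v, g)) ∧
      ∀ v g : V N, ‖Ψ (v, g)‖ ≤ ‖(Real.exp (-(α * τ)) : ℂ) • v + g‖ := by
  obtain ⟨τ₁, h0, h1⟩ := exists_drift_dichotomy N
  refine ⟨min τ₁ 1, by positivity, fun τ hτ hτ1 lam hlam α => ?_⟩
  have hD := contDiff_cubic_expansion (Finset.range N) (coeffCLM N)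
    (fun m : Fin N => (⟨e m, e_mem_V m.2⟩ : V N))
    (fun i j k m => ∫ x in Set.Ioo (0 : ℝ) 1, eFun i x * eFun k x * eFun j x * eFun m x)
    (fun m => ((-(((m : ℝ) + 1) * Real.pi) ^ 2 : ℝ) : ℂ)) lam
  simp_rw [coeffCLM_apply, ← coeff_mul_expansion, ← coeff_cubic, ← drift_eq_sum] at hD
  obtain ⟨Ψ, hc, hΨ⟩ := exists_implicit_solution (NNReal.coe_pos.2 hτ)
    (hτ1.trans (min_le_right _ _)) hD (im_inner_drift N lam)
    (h1 τ hτ (hτ1.trans (min_le_left _ _)) lam hlam)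
  refine ⟨fun p => Ψ ((Real.exp (-(α * τ)) : ℂ) • p.1,
    (Real.exp (-(α * τ)) : ℂ) • p.1 + p.2),
    by fun_prop, fun v g u => (step_iff v u g).trans (hΨ _ _ _), fun v g => ?_⟩
  have h := norm_le_norm_implicitMap (τ := τ) (im_inner_drift N lam
    ((Real.exp (-(α * τ)) : ℂ) • v) (Ψ ((Real.exp (-(α * τ)) : ℂ) • v,
      (Real.exp (-(α * τ)) : ℂ) • v + g)))
  rwa [(hΨ _ _ _).2 rfl] at h

end Drift

/-! ### Deterministic inequalities behind the moment recursion. -/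

section Inequalities

lemma pow_mul_pow_le_add {x y : ℝ} (hx : 0 ≤ x) (hy : 0 ≤ y) (q i j : ℕ) (hij : i + j = 2 * q) :
    x ^ i * y ^ j * y ^ 2 ≤ x ^ (2 * q) * y ^ 2 + y ^ (2 * q) * y ^ 2 := by
  rw [← add_mul]
  refine mul_le_mul_of_nonneg_right ?_ (sq_nonneg y)
  rcases le_total x y with h | h
  · calc x ^ i * y ^ j ≤ y ^ i * y ^ j := by gcongr
      _ = y ^ (2 * q) := by rw [← pow_add, hij]
      _ ≤ _ := le_add_of_nonneg_left (by positivity)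
  · calc x ^ i * y ^ j ≤ x ^ i * x ^ j := by gcongr
      _ = x ^ (2 * q) := by rw [← pow_add, hij]
      _ ≤ _ := le_add_of_nonneg_right (by positivity)

/-- Second-order Taylor bound for even powers of the norm of a sum; `r` stands for the inner
product. -/
lemma exists_pow_add_le (q : ℕ) : ∃ C : ℝ, 0 ≤ C ∧ ∀ x y r : ℝ, 0 ≤ x → 0 ≤ y → |r| ≤ x * y →
    (x ^ 2 + 2 * r + y ^ 2) ^ (q + 1) ≤ x ^ (2 * (q + 1)) + 2 * (q + 1) * (x ^ (2 * q) * r) +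
      C * (x ^ (2 * q) * y ^ 2 + y ^ (2 * (q + 1))) := by
  induction q with
  | zero =>
    refine ⟨1, zero_le_one, fun x y r _ _ _ => ?_⟩
    norm_num
    nlinarith [sq_nonneg y]
  | succ q ih =>
    obtain ⟨C, hC, h⟩ := ih
    -- After multiplying the induction hypothesis by `x² + 2r + y²`, each error is at most a
    -- multiple of `T`: `1` from `x^{2(q+1)}y²`, `4(q+1)` from `x^{2q}r²`, `2(q+1)` from
    -- `x^{2q}ry²`, and `8C` from the old remainder.
    refine ⟨1 + 6 * (q + 1) + 8 * C, by positivity, fun x y r hx hy hr => ?_⟩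
    obtain ⟨hr1, hr2⟩ := abs_le.1 hr
    have hA0 : 0 ≤ x ^ 2 + 2 * r + y ^ 2 := by nlinarith [sq_nonneg (x - y)]
    have hA1 : x ^ 2 + 2 * r + y ^ 2 ≤ 2 * x ^ 2 + 2 * y ^ 2 := by nlinarith [sq_nonneg (x - y)]
    have e1 := pow_mul_pow_le_add hx hy (q + 1) (2 * (q + 1)) 0 (by ring)
    have e2 := pow_mul_pow_le_add hx hy (q + 1) (2 * q + 1) 1 (by ring)
    have e3 := pow_mul_pow_le_add hx hy (q + 1) 2 (2 * q) (by ring)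
    have e4 := pow_mul_pow_le_add hx hy (q + 1) (2 * q) 2 (by ring)
    set T := x ^ (2 * (q + 1)) * y ^ 2 + y ^ (2 * (q + 1)) * y ^ 2 with hT
    have hr3 : r ^ 2 ≤ (x * y) ^ 2 := sq_le_sq' hr1 hr2
    have t1 : x ^ (2 * q) * r ^ 2 ≤ T := by
      refine le_trans (mul_le_mul_of_nonneg_left hr3 (by positivity)) (le_trans (le_of_eq ?_) e1)
      ring
    have t2 : x ^ (2 * q) * r * y ^ 2 ≤ T := by
      refine le_trans (mul_le_mul_of_nonneg_right (mul_le_mul_of_nonneg_left hr2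
        (by positivity : 0 ≤ x ^ (2 * q))) (sq_nonneg y)) (le_trans (le_of_eq ?_) e2)
      ring
    have t3 : (x ^ 2 + 2 * r + y ^ 2) * (x ^ (2 * q) * y ^ 2 + y ^ (2 * (q + 1))) ≤ 8 * T := by
      have hyT : y ^ (2 * (q + 1)) * y ^ 2 ≤ T := le_add_of_nonneg_left (by positivity)
      have hxT : x ^ (2 * (q + 1)) * y ^ 2 ≤ T := le_add_of_nonneg_right (by positivity)
      have e3' : x ^ 2 * y ^ (2 * (q + 1)) ≤ T := by
        refine le_trans (le_of_eq ?_) e3; ring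
      have e4' : y ^ 2 * (x ^ (2 * q) * y ^ 2) ≤ T := by
        refine le_trans (le_of_eq ?_) e4; ring
      calc _ ≤ (2 * x ^ 2 + 2 * y ^ 2) * (x ^ (2 * q) * y ^ 2 + y ^ (2 * (q + 1))) := by gcongr
        _ = 2 * (x ^ (2 * (q + 1)) * y ^ 2) + 2 * (x ^ 2 * y ^ (2 * (q + 1))) +
          2 * (y ^ 2 * (x ^ (2 * q) * y ^ 2)) + 2 * (y ^ (2 * (q + 1)) * y ^ 2) := by ring
        _ ≤ 8 * T := by linarith
    have hTe : T = x ^ (2 * (q + 1)) * y ^ 2 + y ^ (2 * (q + 1 + 1)) := by rw [hT]; ring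
    have t0 : x ^ (2 * (q + 1)) * y ^ 2 ≤ T := le_add_of_nonneg_right (by positivity)
    calc (x ^ 2 + 2 * r + y ^ 2) ^ (q + 1 + 1)
        = (x ^ 2 + 2 * r + y ^ 2) * (x ^ 2 + 2 * r + y ^ 2) ^ (q + 1) := by ring
      _ ≤ (x ^ 2 + 2 * r + y ^ 2) * (x ^ (2 * (q + 1)) + 2 * (q + 1) * (x ^ (2 * q) * r) +
          C * (x ^ (2 * q) * y ^ 2 + y ^ (2 * (q + 1)))) := by gcongr; exact h x y r hx hy hr
      _ = x ^ (2 * (q + 1 + 1)) + 2 * (q + 1 + 1) * (x ^ (2 * (q + 1)) * r) +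
          (x ^ (2 * (q + 1)) * y ^ 2 + 4 * (q + 1) * (x ^ (2 * q) * r ^ 2) +
            2 * (q + 1) * (x ^ (2 * q) * r * y ^ 2) +
          C * ((x ^ 2 + 2 * r + y ^ 2) * (x ^ (2 * q) * y ^ 2 + y ^ (2 * (q + 1))))) := by ring
      _ ≤ x ^ (2 * (q + 1 + 1)) + 2 * (q + 1 + 1) * (x ^ (2 * (q + 1)) * r) +
          (T + 4 * (q + 1) * T + 2 * (q + 1) * T + C * (8 * T)) := by gcongr
      _ = _ := by rw [← hTe]; push_cast; ring

/-- The term linear in `g` is kept exactly, since it will average to zero. -/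
lemma exists_norm_add_pow_le (q : ℕ) : ∃ C : ℝ, 0 ≤ C ∧
    ∀ {E : Type*} [NormedAddCommGroup E] [InnerProductSpace ℂ E] (w g : E),
      ‖w + g‖ ^ (2 * (q + 1)) ≤ ‖w‖ ^ (2 * (q + 1)) +
        2 * (q + 1) * (‖w‖ ^ (2 * q) * (inner ℂ w g).re) +
        C * (‖w‖ ^ (2 * q) * ‖g‖ ^ 2 + ‖g‖ ^ (2 * (q + 1))) := by
  obtain ⟨C, hC, h⟩ := exists_pow_add_le q
  refine ⟨C, hC, fun {E} _ _ w g => ?_⟩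
  have h1 := norm_add_sq (𝕜 := ℂ) w g
  rw [RCLike.re_eq_complex_re] at h1
  rw [pow_mul, h1]
  exact h _ _ _ (norm_nonneg _) (norm_nonneg _)
    ((Complex.abs_re_le_norm _).trans (norm_inner_le_norm _ _))

/-- Jensen with weights `η m / S`: the constant involves the sum of the `η m` and not the number of
modes. -/
lemma sum_mul_pow_le (s : Finset ℕ) {η X : ℕ → ℝ} (hη : ∀ m, 0 ≤ η m) (hX : ∀ m, 0 ≤ X m)
    (q : ℕ) : (∑ m ∈ s, η m * X m) ^ (q + 1) ≤
      (∑ m ∈ s, η m) ^ q * ∑ m ∈ s, η m * X m ^ (q + 1) := by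
  rcases (Finset.sum_nonneg fun m (_ : m ∈ s) => hη m).eq_or_lt with h | h
  · have h0 := (Finset.sum_eq_zero_iff_of_nonneg fun m _ => hη m).1 h.symm
    have h1 : ∀ Y : ℕ → ℝ, ∑ m ∈ s, η m * Y m = 0 := fun Y =>
      Finset.sum_eq_zero fun m hm => by rw [h0 m hm, zero_mul]
    rw [h1, h1 fun m => X m ^ (q + 1), zero_pow (Nat.succ_ne_zero q), mul_zero]
  · set S := ∑ m ∈ s, η m
    have h1 := Real.pow_arith_mean_le_arith_mean_pow s (fun m => η m / S) X
      (fun m _ => div_nonneg (hη m) h.le) (by rw [← Finset.sum_div]; exact div_self h.ne')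
      (fun m _ => hX m) (q + 1)
    simp_rw [div_mul_eq_mul_div, ← Finset.sum_div] at h1
    rw [div_pow, div_le_iff₀ (by positivity)] at h1
    refine h1.trans_eq ?_
    field_simp
    ring

/-- The moment bounds obtained by solving the recursive inequalities. -/
noncomputable def momentBound (α : ℝ) (D : ℕ → ℝ) (R : ℝ) : ℕ → ℝ
  | 0 => 1
  | q + 1 => R ^ (2 * (q + 1)) + 2 / α * (D q * (momentBound α D R q + 1))

lemma momentBound_nonneg {α : ℝ} (hα : 0 < α) {D : ℕ → ℝ} (hD : ∀ q, 0 ≤ D q) {R : ℝ}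
    (hR : 0 ≤ R) (q : ℕ) : 0 ≤ momentBound α D R q := by
  induction q with
  | zero => exact zero_le_one
  | succ q ih =>
    have := hD q
    rw [momentBound]; positivity

/-- For `0 ≤ x ≤ 1`, `e^{-x} ≤ 1/(1+x) ≤ 1 - x/2`. So a step frees a fraction `ατ/2` of the bound,
and the factor `2/α` in `momentBound` makes this enough to pay for the forcing. -/
lemma le_momentBound {α τ : ℝ} (hα : 0 < α) (hτ : 0 ≤ τ) (hτα : α * τ ≤ 1) {D : ℕ → ℝ}
    (hD : ∀ q, 0 ≤ D q) {R : ℝ} (hR : 0 ≤ R) {M : ℕ → ℕ → ℝ} (h0 : ∀ k, M 0 k ≤ 1)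
    (hinit : ∀ q, M q 0 ≤ R ^ (2 * q))
    (hstep : ∀ q k, M (q + 1) (k + 1) ≤
      Real.exp (-(α * τ)) * M (q + 1) k + τ * (D q * (M q k + 1))) (q k : ℕ) :
    M q k ≤ momentBound α D R q := by
  induction q generalizing k with
  | zero => exact h0 k
  | succ q ihq =>
    have hDq := hD q
    have hBq := momentBound_nonneg hα hD hR q
    have hx : 0 ≤ α * τ := by positivity
    induction k with
    | zero =>
      refine (hinit _).trans ?_
      rw [momentBound]
      exact le_add_of_nonneg_right (by positivity)
    | succ k ihk =>
      set B := momentBound α D R q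
      set B' := momentBound α D R (q + 1) with hB'
      have hB'2 : 2 / α * (D q * (B + 1)) ≤ B' := by
        rw [hB', momentBound]
        exact le_add_of_nonneg_left (by positivity)
      have hexp : Real.exp (-(α * τ)) ≤ 1 - α * τ / 2 := by
        have h1 := Real.add_one_le_exp (α * τ)
        rw [Real.exp_neg, inv_le_comm₀ (Real.exp_pos _) (by linarith)]
        refine le_trans ?_ h1
        rw [inv_le_iff_one_le_mul₀ (by linarith)]
        nlinarith
      have h1 : M q k + 1 ≤ B + 1 := add_le_add (ihq k) le_rfl
      have hB'0 : 0 ≤ B' := le_trans (by positivity) hB'2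
      have h3 : τ * (D q * (B + 1)) ≤ α * τ / 2 * B' := by
        calc τ * (D q * (B + 1)) = α * τ / 2 * (2 / α * (D q * (B + 1))) := by field_simp
          _ ≤ _ := by gcongr
      calc M (q + 1) (k + 1)
          ≤ Real.exp (-(α * τ)) * M (q + 1) k + τ * (D q * (M q k + 1)) := hstep q k
        _ ≤ Real.exp (-(α * τ)) * B' + τ * (D q * (B + 1)) := by gcongr
        _ ≤ (1 - α * τ / 2) * B' + α * τ / 2 * B' := by gcongr
        _ = B' := by ring

end Inequalities

/-! ### Gaussian moments of the noise increments. -/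

section Noise

lemma integral_pow_gaussianReal (v : ℝ≥0) (n : ℕ) :
    ∫ x, x ^ (2 * n) ∂gaussianReal 0 v = (v : ℝ) ^ n * ∫ x, x ^ (2 * n) ∂gaussianReal 0 1 := by
  have h : gaussianReal 0 v = (gaussianReal 0 1).map (Real.sqrt v * ·) := by
    rw [gaussianReal_map_const_mul]
    congr 1
    · simp
    · ext; simp
  rw [h, integral_map (by fun_prop) (by fun_prop), ← integral_const_mul]
  congr 1; ext x
  rw [mul_pow, pow_mul (Real.sqrt v), Real.sq_sqrt v.coe_nonneg]

variable {Ω : Type*} {mΩ : MeasurableSpace Ω} {P : Measure Ω}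
  {F : Filtration ℝ≥0 mΩ} {β : ℕ → ℝ≥0 → Ω → ℂ}

lemma hasLaw_component_sub (hβ : IsWienerFamily P F β) (q : ℕ × Bool) {s t : ℝ≥0} (hst : s ≤ t) :
    HasLaw (fun ω => component β q t ω - component β q s ω) (gaussianReal 0 (t - s)) P := by
  have h := (hβ.brownian q).toIsPreBrownianReal.hasLaw_sub t s
  have h2 : nndist t.1 s.1 = t - s := by
    ext
    rw [coe_nndist, NNReal.coe_sub hst, Real.dist_eq]
    exact abs_of_nonneg (sub_nonneg.2 hst)
  rw [h2] at h
  exact h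

/-- The noise increment as an element of `V N`. -/
noncomputable def noiseV (N : ℕ) (η : ℕ → ℝ) (β : ℕ → ℝ≥0 → Ω → ℂ) (s t : ℝ≥0) (ω : Ω) : V N :=
  ⟨noise N η β s t ω, sum_smul_e_mem_V N _⟩

lemma norm_noiseV_sq (N : ℕ) {η : ℕ → ℝ} (hη : ∀ m, 0 ≤ η m) (s t : ℝ≥0) (ω : Ω) :
    ‖noiseV N η β s t ω‖ ^ 2 = ∑ m ∈ Finset.range N, η m * ‖β m t ω - β m s ω‖ ^ 2 := by
  rw [Submodule.coe_norm, norm_sq_eq_sum (noiseV N η β s t ω).2]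
  refine Finset.sum_congr rfl fun m hm => ?_
  have h : (noiseV N η β s t ω : L2) = ∑ m ∈ Finset.range N,
      ((Real.sqrt (η m) : ℂ) * (β m t ω - β m s ω)) • e m := rfl
  rw [← inner_e, h, inner_e_sum N fun m => (Real.sqrt (η m) : ℂ) * (β m t ω - β m s ω), if_pos (Finset.mem_range.1 hm), norm_mul, mul_pow,
    Complex.norm_real, Real.norm_of_nonneg (Real.sqrt_nonneg _), Real.sq_sqrt (hη m)]

lemma noiseV_eq_sum (N : ℕ) (η : ℕ → ℝ) (s t : ℝ≥0) (ω : Ω) :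
    noiseV N η β s t ω = ∑ m : Fin N, ((Real.sqrt (η m) : ℂ) * (β m t ω - β m s ω)) •
      (⟨e m, e_mem_V m.2⟩ : V N) := by
  refine Subtype.ext ?_
  rw [AddSubmonoidClass.coe_finsetSum]
  exact Finset.sum_range _

lemma stronglyMeasurable_noiseV (hβ : IsWienerFamily P F β) (N : ℕ) (η : ℕ → ℝ) {s t : ℝ≥0}
    (hst : s ≤ t) : StronglyMeasurable[F t] (noiseV N η β s t) := by
  have h : noiseV N η β s t = fun ω => ∑ m : Fin N,
      ((Real.sqrt (η m) : ℂ) * (β m t ω - β m s ω)) • (⟨e m, e_mem_V m.2⟩ : V N) :=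
    funext fun ω => noiseV_eq_sum N η s t ω
  rw [h]
  refine Finset.stronglyMeasurable_fun_sum _ fun m _ => StronglyMeasurable.smul_const ?_ _
  exact ((hβ.adapted m t).sub ((hβ.adapted m s).mono (F.mono hst))).const_mul _

lemma memLp_component_sub (hβ : IsWienerFamily P F β) (q : ℕ × Bool) {s t : ℝ≥0} (hst : s ≤ t)
    (p : ℝ≥0) : MemLp (fun ω => component β q t ω - component β q s ω) p P := by
  have h := hasLaw_component_sub hβ q hst
  have h2 := memLp_id_gaussianReal (μ := 0) (v := t - s) p
  rw [← h.map_eq] at h2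
  exact (memLp_map_measure_iff aestronglyMeasurable_id h.aemeasurable).1 h2

lemma integral_pow_component_sub (hβ : IsWienerFamily P F β) (q : ℕ × Bool) {s t : ℝ≥0}
    (hst : s ≤ t) (n : ℕ) :
    ∫ ω, (component β q t ω - component β q s ω) ^ (2 * n) ∂P =
      ((t - s : ℝ≥0) : ℝ) ^ n * ∫ x, x ^ (2 * n) ∂gaussianReal 0 1 := by
  rw [← integral_pow_gaussianReal]
  exact (hasLaw_component_sub hβ q hst).integral_comp (f := fun x : ℝ => x ^ (2 * n))
    (by fun_prop)

lemma memLp_increment (hβ : IsWienerFamily P F β) (m : ℕ) {s t : ℝ≥0} (hst : s ≤ t) (p : ℝ≥0) :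
    MemLp (fun ω => β m t ω - β m s ω) p P := by
  refine memLp_re_im_iff.1 ⟨?_, ?_⟩
  · simpa [component] using memLp_component_sub hβ (m, false) hst p
  · simpa [component] using memLp_component_sub hβ (m, true) hst p

lemma integral_increment (hβ : IsWienerFamily P F β) (m : ℕ) {s t : ℝ≥0} (hst : s ≤ t) :
    ∫ ω, (β m t ω - β m s ω) ∂P = 0 := by
  have hi : Integrable (fun ω => β m t ω - β m s ω) P :=
    memLp_one_iff_integrable.1 (by simpa using memLp_increment hβ m hst 1)
  have h : ∀ q : ℕ × Bool, ∫ ω, (component β q t ω - component β q s ω) ∂P = 0 := fun q => by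
    rw [(hasLaw_component_sub hβ q hst).integral_eq, integral_id_gaussianReal]
  apply Complex.ext
  · have h1 := integral_re (𝕜 := ℂ) hi
    simp only [RCLike.re_eq_complex_re] at h1
    rw [← h1]
    simpa [component] using h (m, false)
  · have h1 := integral_im (𝕜 := ℂ) hi
    simp only [RCLike.im_eq_complex_im] at h1
    rw [← h1]
    simpa [component] using h (m, true)

lemma memLp_noiseV (hβ : IsWienerFamily P F β) (N : ℕ) (η : ℕ → ℝ) {s t : ℝ≥0}
    (hst : s ≤ t) (p : ℝ≥0) : MemLp (noiseV N η β s t) p P := by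
  have hb : MemLp (fun ω => ∑ m ∈ Finset.range N,
      Real.sqrt (η m) * ‖β m t ω - β m s ω‖) p P :=
    memLp_finsetSum _ fun m _ => (memLp_increment hβ m hst p).norm.const_mul _
  refine hb.mono' ((stronglyMeasurable_noiseV hβ N η hst).mono (F.le t)).aestronglyMeasurable
    (Filter.Eventually.of_forall fun ω => ?_)
  change ‖(noise N η β s t ω : L2)‖ ≤ _
  refine norm_sum_le_of_le _ fun m _ => ?_
  rw [norm_smul, orthonormal_e.1 m, mul_one, norm_mul, Complex.norm_real,
    Real.norm_of_nonneg (Real.sqrt_nonneg _)]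

variable [IsProbabilityMeasure P]

lemma integrable_norm_pow_of_memLp {H : Type*} [NormedAddCommGroup H] {f : Ω → H}
    (hf : ∀ p : ℝ≥0, MemLp f p P) (n : ℕ) : Integrable (fun ω => ‖f ω‖ ^ n) P := by
  have := hf n
  simp only [ENNReal.coe_natCast] at this
  exact this.integrable_norm_pow'

lemma integral_norm_increment_pow_le (hβ : IsWienerFamily P F β) (m : ℕ) {s t : ℝ≥0}
    (hst : s ≤ t) (n : ℕ) : ∫ ω, ‖β m t ω - β m s ω‖ ^ (2 * n) ∂P ≤
      2 ^ n * (2 * ∫ x, x ^ (2 * n) ∂gaussianReal 0 1) * ((t - s : ℝ≥0) : ℝ) ^ n := by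
  have hint : ∀ q : ℕ × Bool,
      Integrable (fun ω => (component β q t ω - component β q s ω) ^ (2 * n)) P := by
    intro q
    have := integrable_norm_pow_of_memLp (memLp_component_sub hβ q hst) (2 * n)
    simpa only [Real.norm_eq_abs, pow_mul, sq_abs] using this
  calc ∫ ω, ‖β m t ω - β m s ω‖ ^ (2 * n) ∂P
      ≤ ∫ ω, 2 ^ n * ((component β (m, false) t ω - component β (m, false) s ω) ^ (2 * n) +
        (component β (m, true) t ω - component β (m, true) s ω) ^ (2 * n)) ∂P := by
        refine integral_mono (integrable_norm_pow_of_memLp (memLp_increment hβ m hst) _)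
          (((hint _).add (hint _)).const_mul _) fun ω => ?_
        simp only [pow_mul, ← Complex.normSq_eq_norm_sq, Complex.normSq_apply, ← sq]
        refine (add_pow_le (sq_nonneg _) (sq_nonneg _) n).trans ?_
        simp only [Complex.sub_re, Complex.sub_im, component, if_true, Bool.false_eq_true,
          if_false]
        gcongr
        · exact one_le_two
        · exact Nat.sub_le _ _
    _ = _ := by
        rw [integral_const_mul, integral_add (hint _) (hint _),
          integral_pow_component_sub hβ _ hst, integral_pow_component_sub hβ _ hst]
        ring

/-- Partial sums of `η` are at most the full sum, which makes the bound uniform in `N`. -/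
lemma integral_norm_noiseV_pow_le (hβ : IsWienerFamily P F β) (N : ℕ) {η : ℕ → ℝ}
    (hη : ∀ m, 0 ≤ η m) (hs : Summable η) {s t : ℝ≥0} (hst : s ≤ t) (q : ℕ) :
    ∫ ω, ‖noiseV N η β s t ω‖ ^ (2 * (q + 1)) ∂P ≤ (∑' m, η m) ^ (q + 1) *
      (2 ^ (q + 1) * (2 * ∫ x, x ^ (2 * (q + 1)) ∂gaussianReal 0 1)) *
      ((t - s : ℝ≥0) : ℝ) ^ (q + 1) := by
  set c : ℝ := 2 ^ (q + 1) * (2 * ∫ x, x ^ (2 * (q + 1)) ∂gaussianReal 0 1) with hc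
  have hc0 : 0 ≤ c := by
    have : 0 ≤ ∫ x, x ^ (2 * (q + 1)) ∂gaussianReal 0 1 := integral_nonneg fun x => by
      rw [Pi.zero_apply, pow_mul]; positivity
    positivity
  have hi : ∀ m, Integrable (fun ω => ‖β m t ω - β m s ω‖ ^ (2 * (q + 1))) P := fun m =>
    integrable_norm_pow_of_memLp (memLp_increment hβ m hst) _
  have hS0 : 0 ≤ ∑ m ∈ Finset.range N, η m := Finset.sum_nonneg fun m _ => hη m
  have hS : ∑ m ∈ Finset.range N, η m ≤ ∑' m, η m := hs.sum_le_tsum _ fun m _ => hη m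
  calc ∫ ω, ‖noiseV N η β s t ω‖ ^ (2 * (q + 1)) ∂P
      ≤ ∫ ω, (∑ m ∈ Finset.range N, η m) ^ q *
        ∑ m ∈ Finset.range N, η m * ‖β m t ω - β m s ω‖ ^ (2 * (q + 1)) ∂P := by
        refine integral_mono (integrable_norm_pow_of_memLp (memLp_noiseV hβ N η hst) _)
          ((integrable_finsetSum _ fun m _ => (hi m).const_mul _).const_mul _) fun ω => ?_
        simp only [pow_mul _ 2, norm_noiseV_sq N hη]
        exact sum_mul_pow_le _ hη (fun m => sq_nonneg _) q
    _ = (∑ m ∈ Finset.range N, η m) ^ q *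
        ∑ m ∈ Finset.range N, η m * ∫ ω, ‖β m t ω - β m s ω‖ ^ (2 * (q + 1)) ∂P := by
        rw [integral_const_mul, integral_finsetSum _ fun m _ => (hi m).const_mul _]
        simp_rw [integral_const_mul]
    _ ≤ (∑ m ∈ Finset.range N, η m) ^ q *
        ∑ m ∈ Finset.range N, η m * (c * ((t - s : ℝ≥0) : ℝ) ^ (q + 1)) := by
        gcongr with m _
        · exact hη m
        · exact integral_norm_increment_pow_le hβ m hst _
    _ = (∑ m ∈ Finset.range N, η m) ^ (q + 1) * (c * ((t - s : ℝ≥0) : ℝ) ^ (q + 1)) := by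
        rw [← Finset.sum_mul, pow_succ]; ring
    _ ≤ (∑' m, η m) ^ (q + 1) * (c * ((t - s : ℝ≥0) : ℝ) ^ (q + 1)) := by gcongr
    _ = _ := by ring

end Noise

/-! ### Independence of the past and uniform moment bounds. -/

section Moments

variable {Ω : Type*} {mΩ : MeasurableSpace Ω} {P : Measure Ω}
  {F : Filtration ℝ≥0 mΩ} {β : ℕ → ℝ≥0 → Ω → ℂ}

/-- Independence from the whole family at once is needed because `‖g‖²` involves several modes
jointly. -/
lemma indepFun_increments {H : Type*} [TopologicalSpace H]
    [TopologicalSpace.PseudoMetrizableSpace H] [MeasurableSpace H] [BorelSpace H] (hβ : IsWienerFamily P F β) {s t : ℝ≥0} (hst : s ≤ t)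
    {X : Ω → H} (hX : StronglyMeasurable[F s] X) :
    IndepFun X (fun ω (m : ℕ) => β m t ω - β m s ω) P := by
  rw [IndepFun_iff_Indep]
  exact (indep_of_indep_of_le_right (hβ.indep_past s t hst) hX.measurable.comap_le).symm

lemma memLp_complex_smul {H : Type*} [NormedAddCommGroup H] [NormedSpace ℂ H] {f : Ω → H}
    {p : ℝ≥0} (hf : MemLp f p P) (a : ℂ) : MemLp (fun ω => a • f ω) p P := hf.const_smul a

lemma integral_mul_increment (hβ : IsWienerFamily P F β) {s t : ℝ≥0} (hst : s ≤ t) (m : ℕ)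
    {X : Ω → ℂ} (hX : StronglyMeasurable[F s] X) (hXi : Integrable X P) :
    Integrable (fun ω => X ω * (β m t ω - β m s ω)) P ∧
      ∫ ω, X ω * (β m t ω - β m s ω) ∂P = 0 := by
  have hind : IndepFun X (fun ω => β m t ω - β m s ω) P :=
    (indepFun_increments hβ hst hX).comp measurable_id (measurable_pi_apply m)
  have hi : Integrable (fun ω => β m t ω - β m s ω) P :=
    memLp_one_iff_integrable.1 (by simpa using memLp_increment hβ m hst 1)
  refine ⟨hind.integrable_mul hXi hi, ?_⟩
  rw [hind.integral_fun_mul_eq_mul_integral hXi.1 hi.1, integral_increment hβ m hst, mul_zero]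

variable [IsProbabilityMeasure P]

/-- In modes, this is a finite sum of `F s`-measurable factors times centred increments independent
of `F s`. -/
lemma integral_norm_pow_mul_re_inner_noiseV (hβ : IsWienerFamily P F β) (N : ℕ) (η : ℕ → ℝ)
    {s t : ℝ≥0} (hst : s ≤ t) {w : Ω → V N} (hw : StronglyMeasurable[F s] w)
    (hwp : ∀ p : ℝ≥0, MemLp w p P) (n : ℕ) :
    Integrable (fun ω => ‖w ω‖ ^ n * (inner ℂ (w ω) (noiseV N η β s t ω)).re) P ∧
      ∫ ω, ‖w ω‖ ^ n * (inner ℂ (w ω) (noiseV N η β s t ω)).re ∂P = 0 := by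
  set X : ℕ → Ω → ℂ := fun m ω => ((‖w ω‖ ^ n : ℝ) : ℂ) *
    ((Real.sqrt (η m) : ℂ) * (starRingEnd ℂ) (coeffCLM N m (w ω))) with hXdef
  have hXm : ∀ m, StronglyMeasurable[F s] (X m) := fun m => by
    have h1 : StronglyMeasurable[F s] fun ω => (starRingEnd ℂ) (coeffCLM N m (w ω)) :=
      (Complex.continuous_conj.comp (coeffCLM N m).continuous).comp_stronglyMeasurable hw
    have h2 : StronglyMeasurable[F s] fun ω => ((‖w ω‖ ^ n : ℝ) : ℂ) :=
      (Complex.continuous_ofReal.comp (continuous_norm.pow n)).comp_stronglyMeasurable hw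
    exact h2.mul (h1.const_mul _)
  have hXi : ∀ m, Integrable (X m) P := fun m => by
    refine ((integrable_norm_pow_of_memLp hwp (n + 1)).const_mul (Real.sqrt (η m))).mono'
      ((hXm m).mono (F.le s)).aestronglyMeasurable (Filter.Eventually.of_forall fun ω => ?_)
    rw [hXdef, norm_mul, norm_mul, RCLike.norm_conj, Complex.norm_real, Complex.norm_real,
      Real.norm_of_nonneg (Real.sqrt_nonneg _), norm_pow, norm_norm, coeffCLM_apply]
    have := norm_coeff_le (w ω : L2) m
    calc ‖w ω‖ ^ n * (Real.sqrt (η m) * ‖coeff (w ω : L2) m‖)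
        ≤ ‖w ω‖ ^ n * (Real.sqrt (η m) * ‖w ω‖) := by gcongr; exact this
      _ = _ := by ring
  have heq : ∀ ω, ‖w ω‖ ^ n * (inner ℂ (w ω) (noiseV N η β s t ω)).re =
      (∑ m ∈ Finset.range N, X m ω * (β m t ω - β m s ω)).re := by
    intro ω
    have h : inner ℂ (w ω) (noiseV N η β s t ω) = ∑ m ∈ Finset.range N,
        ((Real.sqrt (η m) : ℂ) * (β m t ω - β m s ω)) * (starRingEnd ℂ) (coeff (w ω : L2) m) :=
      inner_sum_smul_e N _ _
    rw [← Complex.re_ofReal_mul, h, Finset.mul_sum]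
    congr 1
    refine Finset.sum_congr rfl fun m _ => ?_
    rw [hXdef, ← coeffCLM_apply]
    ring
  simp_rw [heq]
  have hm := fun m => integral_mul_increment hβ hst m (hXm m) (hXi m)
  have hsum : Integrable (fun ω => ∑ m ∈ Finset.range N, X m ω * (β m t ω - β m s ω)) P :=
    integrable_finsetSum _ fun m _ => (hm m).1
  refine ⟨hsum.re, ?_⟩
  have h1 := integral_re (𝕜 := ℂ) hsum
  simp only [RCLike.re_eq_complex_re] at h1
  rw [h1, integral_finsetSum _ fun m _ => (hm m).1, Finset.sum_eq_zero fun m _ => (hm m).2,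
    Complex.zero_re]

lemma integral_norm_pow_mul_norm_noiseV_sq (hβ : IsWienerFamily P F β) (N : ℕ) {η : ℕ → ℝ}
    (hη : ∀ m, 0 ≤ η m) {s t : ℝ≥0} (hst : s ≤ t) {w : Ω → V N}
    (hw : StronglyMeasurable[F s] w) (hwp : ∀ p : ℝ≥0, MemLp w p P) (n : ℕ) :
    Integrable (fun ω => ‖w ω‖ ^ n * ‖noiseV N η β s t ω‖ ^ 2) P ∧
      ∫ ω, ‖w ω‖ ^ n * ‖noiseV N η β s t ω‖ ^ 2 ∂P =
        (∫ ω, ‖w ω‖ ^ n ∂P) * ∫ ω, ‖noiseV N η β s t ω‖ ^ 2 ∂P := by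
  have hi := integrable_norm_pow_of_memLp hwp n
  have hg := integrable_norm_pow_of_memLp (memLp_noiseV hβ N η hst) 2
  have hind : IndepFun (fun ω => ‖w ω‖ ^ n) (fun ω => ‖noiseV N η β s t ω‖ ^ 2) P := by
    simp_rw [norm_noiseV_sq N hη]
    exact (indepFun_increments hβ hst (hw.norm.pow n)).comp (φ := id)
      (ψ := fun f : ℕ → ℂ => ∑ m ∈ Finset.range N, η m * ‖f m‖ ^ 2) measurable_id
      (by fun_prop)
  exact ⟨hind.integrable_mul hi hg, hind.integral_fun_mul_eq_mul_integral hi.1 hg.1⟩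

/-- Adding an independent noise increment changes the even moments only by a term of the order of
the time step. -/
lemma exists_integral_norm_add_noiseV_pow_le {η : ℕ → ℝ} (hη : ∀ m, 0 ≤ η m) (hs : Summable η)
    (q : ℕ) : ∃ D : ℝ, 0 ≤ D ∧ ∀ {Ω : Type*} {mΩ : MeasurableSpace Ω} (P : Measure Ω)
      [IsProbabilityMeasure P] (F : Filtration ℝ≥0 mΩ) (β : ℕ → ℝ≥0 → Ω → ℂ),
      IsWienerFamily P F β → ∀ (N : ℕ) (s t : ℝ≥0), s ≤ t → t - s ≤ 1 → ∀ w : Ω → V N,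
      StronglyMeasurable[F s] w → (∀ p : ℝ≥0, MemLp w p P) →
      ∫ ω, ‖w ω + noiseV N η β s t ω‖ ^ (2 * (q + 1)) ∂P ≤ ∫ ω, ‖w ω‖ ^ (2 * (q + 1)) ∂P +
        ((t - s : ℝ≥0) : ℝ) * (D * (∫ ω, ‖w ω‖ ^ (2 * q) ∂P + 1)) := by
  obtain ⟨C, hC, hpow⟩ := exists_norm_add_pow_le q
  set K : ℕ → ℝ := fun q => (∑' m, η m) ^ (q + 1) *
    (2 ^ (q + 1) * (2 * ∫ x, x ^ (2 * (q + 1)) ∂gaussianReal 0 1)) with hK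
  have hK0 : ∀ q, 0 ≤ K q := fun q => by
    have h1 : 0 ≤ ∫ x, x ^ (2 * (q + 1)) ∂gaussianReal 0 1 := integral_nonneg fun x => by
      rw [Pi.zero_apply, pow_mul]; positivity
    have h2 : 0 ≤ ∑' m, η m := tsum_nonneg hη
    positivity
  refine ⟨C * (K 0 + K q), mul_nonneg hC (add_nonneg (hK0 0) (hK0 q)),
    fun {Ω} mΩ P _ F β hβ N s t hst hst1 w hw hwp => ?_⟩
  set τ : ℝ := ((t - s : ℝ≥0) : ℝ) with hτ
  have hτ0 : 0 ≤ τ := NNReal.coe_nonneg _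
  have hτ1 : τ ≤ 1 := by exact_mod_cast hst1
  have hgp := memLp_noiseV (P := P) hβ N η hst
  have h1 : ∫ ω, ‖noiseV N η β s t ω‖ ^ 2 ∂P ≤ K 0 * τ := by
    simpa [hK] using integral_norm_noiseV_pow_le hβ N hη hs hst 0
  have h2 : ∫ ω, ‖noiseV N η β s t ω‖ ^ (2 * (q + 1)) ∂P ≤ K q * τ := by
    refine (integral_norm_noiseV_pow_le hβ N hη hs hst q).trans ?_
    refine mul_le_mul_of_nonneg_left ?_ (hK0 q)
    -- One power of `τ` is all the recursion needs.
    exact pow_le_of_le_one hτ0 hτ1 (Nat.succ_ne_zero q)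
  obtain ⟨i1, e1⟩ := integral_norm_pow_mul_re_inner_noiseV hβ N η hst hw hwp (2 * q)
  obtain ⟨i2, e2⟩ := integral_norm_pow_mul_norm_noiseV_sq hβ N hη hst hw hwp (2 * q)
  have i3 := integrable_norm_pow_of_memLp hgp (2 * (q + 1))
  have i4 := integrable_norm_pow_of_memLp hwp (2 * (q + 1))
  have i5 := integrable_norm_pow_of_memLp (fun p => (hwp p).add (hgp p)) (2 * (q + 1))
  have j1 : Integrable (fun ω =>
      2 * ((q : ℝ) + 1) * (‖w ω‖ ^ (2 * q) * (inner ℂ (w ω) (noiseV N η β s t ω)).re)) P :=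
    i1.const_mul _
  have j3 : Integrable (fun ω => ‖w ω‖ ^ (2 * (q + 1)) +
      2 * ((q : ℝ) + 1) * (‖w ω‖ ^ (2 * q) * (inner ℂ (w ω) (noiseV N η β s t ω)).re)) P :=
    i4.add j1
  have j4 : Integrable (fun ω => C * (‖w ω‖ ^ (2 * q) * ‖noiseV N η β s t ω‖ ^ 2 +
      ‖noiseV N η β s t ω‖ ^ (2 * (q + 1)))) P := (i2.add i3).const_mul C
  have hM : 0 ≤ ∫ ω, ‖w ω‖ ^ (2 * q) ∂P := integral_nonneg fun ω => by positivity
  set M := ∫ ω, ‖w ω‖ ^ (2 * q) ∂P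
  calc ∫ ω, ‖w ω + noiseV N η β s t ω‖ ^ (2 * (q + 1)) ∂P
      ≤ ∫ ω, (‖w ω‖ ^ (2 * (q + 1)) +
        2 * (q + 1) * (‖w ω‖ ^ (2 * q) * (inner ℂ (w ω) (noiseV N η β s t ω)).re) +
        C * (‖w ω‖ ^ (2 * q) * ‖noiseV N η β s t ω‖ ^ 2 +
          ‖noiseV N η β s t ω‖ ^ (2 * (q + 1)))) ∂P :=
        integral_mono i5 (j3.add j4) fun ω => hpow _ _
    _ = ∫ ω, ‖w ω‖ ^ (2 * (q + 1)) ∂P + C * (M * ∫ ω, ‖noiseV N η β s t ω‖ ^ 2 ∂P +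
          ∫ ω, ‖noiseV N η β s t ω‖ ^ (2 * (q + 1)) ∂P) := by
        rw [integral_add j3 j4, integral_add i4 j1, integral_const_mul, integral_const_mul, e1,
          integral_add i2 i3, e2, mul_zero, add_zero]
    _ ≤ ∫ ω, ‖w ω‖ ^ (2 * (q + 1)) ∂P + C * (M * (K 0 * τ) + K q * τ) := by gcongr
    _ ≤ _ := by
        have h3 : M * (K 0 * τ) + K q * τ ≤ τ * ((K 0 + K q) * (M + 1)) := by
          nlinarith [mul_nonneg (hK0 0) hτ0, mul_nonneg (mul_nonneg (hK0 q) hτ0) hM]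
        nlinarith [mul_le_mul_of_nonneg_left h3 hC]

lemma gridTime_le_succ (τ : ℝ≥0) (k : ℕ) : gridTime τ k ≤ gridTime τ (k + 1) := by
  unfold gridTime; gcongr; exact Nat.le_succ k

lemma gridTime_succ_sub (τ : ℝ≥0) (k : ℕ) : gridTime τ (k + 1) - gridTime τ k = τ := by
  rw [gridTime, gridTime, Nat.cast_succ, add_mul, one_mul, add_tsub_cancel_left]

/-- Uniform moment bounds for sequences dominated by the damped random walk. -/
theorem exists_moment_bound {α : ℝ} (hα : 0 < α) {η : ℕ → ℝ} (hη : ∀ m, 0 ≤ η m)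
    (hs : Summable η) : ∃ K : ℕ → ℝ → ℝ, (∀ q R, 0 ≤ R → 0 ≤ K q R) ∧
      ∀ {Ω : Type*} {mΩ : MeasurableSpace Ω} (P : Measure Ω)
      [IsProbabilityMeasure P] (F : Filtration ℝ≥0 mΩ) (β : ℕ → ℝ≥0 → Ω → ℂ),
      IsWienerFamily P F β → ∀ (N : ℕ) (τ : ℝ≥0), τ ≤ 1 → α * τ ≤ 1 → ∀ (R : ℝ) (u : ℕ → Ω → V N),
      (∀ k, StronglyMeasurable[F (gridTime τ k)] (u k)) → (∀ ω, ‖u 0 ω‖ ≤ R) →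
      (∀ k ω, ‖u (k + 1) ω‖ ≤ ‖(Real.exp (-(α * τ)) : ℂ) • u k ω +
        noiseV N η β (gridTime τ k) (gridTime τ (k + 1)) ω‖) →
      ∀ k, (∀ p : ℝ≥0, MemLp (u k) p P) ∧ ∀ q, ∫ ω, ‖u k ω‖ ^ (2 * q) ∂P ≤ K q R := by
  choose D hD0 hD using exists_integral_norm_add_noiseV_pow_le hη hs
  refine ⟨fun q R => momentBound α D R q, fun q R hR => momentBound_nonneg hα hD0 hR q,
    fun {Ω} mΩ P _ F β hβ N τ hτ1 hτα R u hu h0 hstep => ?_⟩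
  have hsm := fun k => ((hu k).mono (F.le _)).aestronglyMeasurable (μ := P)
  have hmem : ∀ k, ∀ p : ℝ≥0, MemLp (u k) p P := by
    intro k
    induction k with
    | zero => exact fun p => MemLp.of_bound (hsm 0) R (Filter.Eventually.of_forall h0)
    | succ k ih =>
      exact fun p => ((memLp_complex_smul (ih p) (Real.exp (-(α * τ)))).add
        (memLp_noiseV hβ N η (gridTime_le_succ τ k) p)).mono
        (hsm _) (Filter.Eventually.of_forall (hstep k))
  intro k
  refine ⟨hmem k, fun q => ?_⟩
  -- A sample point is needed to read off `0 ≤ R`.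
  obtain ⟨ω₀⟩ : Nonempty Ω := nonempty_of_isProbabilityMeasure P
  have hR : 0 ≤ R := (norm_nonneg _).trans (h0 ω₀)
  have hx : 0 ≤ α * τ := by positivity
  refine le_momentBound (M := fun q k => ∫ ω, ‖u k ω‖ ^ (2 * q) ∂P) hα τ.coe_nonneg hτα hD0 hR
    (fun k => by simp) (fun q => ?_) (fun q k => ?_) q k
  · calc ∫ ω, ‖u 0 ω‖ ^ (2 * q) ∂P ≤ ∫ _, R ^ (2 * q) ∂P :=
          integral_mono (integrable_norm_pow_of_memLp (hmem 0) _) (integrable_const _)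
            fun ω => pow_le_pow_left₀ (norm_nonneg _) (h0 ω) _
      _ = R ^ (2 * q) := by simp
  · set a : ℝ := Real.exp (-(α * τ)) with ha
    have ha0 : 0 ≤ a := (Real.exp_pos _).le
    have ha1 : a ≤ 1 := Real.exp_le_one_iff.2 (by linarith)
    have hst := gridTime_le_succ τ k
    have hwp : ∀ p : ℝ≥0, MemLp (fun ω => (a : ℂ) • u k ω) p P := fun p =>
      memLp_complex_smul (hmem k p) a
    have h1 := hD q P F β hβ N _ _ hst (by rwa [gridTime_succ_sub]) (fun ω => (a : ℂ) • u k ω)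
      ((continuous_const_smul (a : ℂ)).comp_stronglyMeasurable (hu k)) hwp
    have hn : ∀ ω, ‖(a : ℂ) • u k ω‖ = a * ‖u k ω‖ := fun ω => by
      rw [norm_smul, Complex.norm_real, Real.norm_of_nonneg ha0]
    simp_rw [hn, mul_pow, integral_const_mul, gridTime_succ_sub] at h1
    refine (integral_mono (integrable_norm_pow_of_memLp (hmem (k + 1)) _)
      (integrable_norm_pow_of_memLp (fun p => (hwp p).add (memLp_noiseV hβ N η hst p)) _)
      fun ω => pow_le_pow_left₀ (norm_nonneg _) (hstep k ω) _).trans (h1.trans ?_)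
    have hM : ∀ n, 0 ≤ ∫ ω, ‖u k ω‖ ^ n ∂P := fun n => integral_nonneg fun ω => by positivity
    -- A single factor `a = e^{-ατ}` of damping suffices for `le_momentBound`.
    have h2 : a ^ (2 * (q + 1)) ≤ a := pow_le_of_le_one ha0 ha1 (by omega)
    have h3 : a ^ (2 * q) * ∫ ω, ‖u k ω‖ ^ (2 * q) ∂P ≤ ∫ ω, ‖u k ω‖ ^ (2 * q) ∂P :=
      mul_le_of_le_one_left (hM _) (pow_le_one₀ ha0 ha1)
    have := hM (2 * (q + 1))
    have := hD0 q
    gcongr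

end Moments

/-! ### Construction and uniqueness of the adapted solution. -/

section Solution

variable {Ω : Type*} {mΩ : MeasurableSpace Ω}

/-- The solution of the scheme obtained by iterating a solution map `Ψ`. -/
noncomputable def iterSolution (N : ℕ) (η : ℕ → ℝ) (u₀ : L2) (β : ℕ → ℝ≥0 → Ω → ℂ) (τ : ℝ≥0)
    (Ψ : V N × V N → V N) : ℕ → Ω → V N
  | 0, _ => ⟨proj N u₀, proj_mem_V N _⟩
  | k + 1, ω => Ψ (iterSolution N η u₀ β τ Ψ k ω,
      noiseV N η β (gridTime τ k) (gridTime τ (k + 1)) ω)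

lemma stronglyMeasurable_iterSolution {P : Measure Ω} {F : Filtration ℝ≥0 mΩ}
    {β : ℕ → ℝ≥0 → Ω → ℂ} (hβ : IsWienerFamily P F β) (N : ℕ) (η : ℕ → ℝ) (u₀ : L2) (τ : ℝ≥0)
    {Ψ : V N × V N → V N} (hΨ : Continuous Ψ) (k : ℕ) :
    StronglyMeasurable[F (gridTime τ k)] (iterSolution N η u₀ β τ Ψ k) := by
  induction k with
  | zero => exact stronglyMeasurable_const
  | succ k ih =>
    exact hΨ.comp_stronglyMeasurable ((ih.mono (F.mono (gridTime_le_succ τ k))).prodMk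
      (stronglyMeasurable_noiseV hβ N η (gridTime_le_succ τ k)))

lemma isAdaptedSolution_iterSolution {P : Measure Ω} {F : Filtration ℝ≥0 mΩ}
    {β : ℕ → ℝ≥0 → Ω → ℂ} (hβ : IsWienerFamily P F β) {N : ℕ} {α lam : ℝ} (η : ℕ → ℝ) (u₀ : L2)
    {τ : ℝ≥0} {Ψ : V N × V N → V N} (hΨ : Continuous Ψ)
    (hstep : ∀ v g u : V N, Step N α lam τ v u g ↔ u = Ψ (v, g)) :
    IsAdaptedSolution N α lam η u₀ P F β τ (iterSolution N η u₀ β τ Ψ) where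
  adapted := stronglyMeasurable_iterSolution hβ N η u₀ τ hΨ
  init := Filter.Eventually.of_forall fun _ => rfl
  step _ := Filter.Eventually.of_forall fun ω => (hstep _ (noiseV N η β _ _ ω) _).2 rfl

/-- On the full-measure event where the countably many step equations hold, `Ψ` determines the path
recursively. -/
lemma ae_eq_iterSolution {P : Measure Ω} {F : Filtration ℝ≥0 mΩ}
    {β : ℕ → ℝ≥0 → Ω → ℂ} {N : ℕ} {α lam : ℝ} {η : ℕ → ℝ} {u₀ : L2}
    {τ : ℝ≥0} {Ψ : V N × V N → V N}
    (hstep : ∀ v g u : V N, Step N α lam τ v u g ↔ u = Ψ (v, g)) {v : ℕ → Ω → V N}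
    (hv : IsAdaptedSolution N α lam η u₀ P F β τ v) :
    ∀ᵐ ω ∂P, ∀ k, v k ω = iterSolution N η u₀ β τ Ψ k ω := by
  filter_upwards [hv.init, ae_all_iff.2 hv.step] with ω h0 h1 k
  induction k with
  | zero => exact Subtype.ext h0
  | succ k ih =>
    rw [(hstep _ (noiseV N η β _ _ ω) _).1 (h1 k), ih, iterSolution]

end Solution

end DampedNLS

theorem mainTheorem8 (α : ℝ) (hα : 0 < α) :
    ∃ τ₀ : ℕ → ℝ, (∀ N, 0 < τ₀ N) ∧
      ∀ η : ℕ → ℝ, (∀ m, 0 ≤ η m) → Summable η →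
        ∃ C : ℕ → DampedNLS.L2 → ℝ, (∀ p v, 0 < C p v) ∧
          ∀ (lam : ℝ), (lam = -1 ∨ lam = 0 ∨ lam = 1) →
          ∀ (N : ℕ) (u₀ : DampedNLS.L2)
            {Ω : Type*} {mΩ : MeasurableSpace Ω} (P : Measure Ω) [IsProbabilityMeasure P]
            (F : Filtration ℝ≥0 mΩ) (β : ℕ → ℝ≥0 → Ω → ℂ),
            DampedNLS.IsWienerFamily P F β →
          ∀ τ : ℝ≥0, 0 < τ → (τ : ℝ) ≤ τ₀ N →
            ∃ u : ℕ → Ω → DampedNLS.V N,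
              DampedNLS.IsAdaptedSolution N α lam η u₀ P F β τ u ∧
              (∀ v : ℕ → Ω → DampedNLS.V N,
                DampedNLS.IsAdaptedSolution N α lam η u₀ P F β τ v →
                  ∀ᵐ ω ∂P, ∀ k, v k ω = u k ω) ∧
              ∀ p : ℕ, 2 ≤ p → ∀ k : ℕ,
                Integrable (fun ω => ‖u k ω‖ ^ p) P ∧
                  ∫ ω, ‖u k ω‖ ^ p ∂P ≤ C p (DampedNLS.proj N u₀) := by
  choose τ₁ hτ₁ hsol using DampedNLS.exists_solution_map
  -- `τ₁ N` serves solvability, `1` the noise moments, and `1 / α` the bound `ατ ≤ 1` in the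
  -- recursion.
  refine ⟨fun N => min (τ₁ N) (min 1 (1 / α)), fun N => by have := hτ₁ N; positivity,
    fun η hη hs => ?_⟩
  obtain ⟨K, hK0, hK⟩ := DampedNLS.exists_moment_bound hα hη hs
  -- Only even moments were bounded; `x^p ≤ 1 + x^{2p}` covers every `p`, and the `1` also makes the
  -- constant positive.
  refine ⟨fun p v => 1 + K p ‖v‖, fun p v => by have := hK0 p ‖v‖ (norm_nonneg v); positivity,
    fun lam hlam N u₀ {Ω} mΩ P _ F β hβ τ hτ hττ => ?_⟩
  have h1 : (τ : ℝ) ≤ τ₁ N := hττ.trans (min_le_left _ _)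
  have h2 : (τ : ℝ) ≤ 1 := hττ.trans ((min_le_right _ _).trans (min_le_left _ _))
  have h3 : (τ : ℝ) ≤ 1 / α := hττ.trans ((min_le_right _ _).trans (min_le_right _ _))
  have h4 : α * τ ≤ 1 := by rwa [le_div_iff₀' hα] at h3
  obtain ⟨Ψ, hΨc, hΨ, hΨn⟩ := hsol N τ hτ h1 lam hlam α
  refine ⟨DampedNLS.iterSolution N η u₀ β τ Ψ,
    DampedNLS.isAdaptedSolution_iterSolution hβ η u₀ hΨc hΨ,
    fun v hv => DampedNLS.ae_eq_iterSolution hΨ hv, fun p _ k => ?_⟩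
  obtain ⟨hmem, hbound⟩ := hK P F β hβ N τ (by exact_mod_cast h2) h4 ‖DampedNLS.proj N u₀‖
    (DampedNLS.iterSolution N η u₀ β τ Ψ)
    (DampedNLS.stronglyMeasurable_iterSolution hβ N η u₀ τ hΨc) (fun _ => le_rfl)
    (fun k ω => hΨn _ _) k
  have hi := DampedNLS.integrable_norm_pow_of_memLp hmem
  refine ⟨hi p, ?_⟩
  calc ∫ ω, ‖DampedNLS.iterSolution N η u₀ β τ Ψ k ω‖ ^ p ∂P
      ≤ ∫ ω, (1 + ‖DampedNLS.iterSolution N η u₀ β τ Ψ k ω‖ ^ (2 * p)) ∂P := by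
        refine integral_mono (hi p) ((integrable_const _).add (hi _)) fun ω => ?_
        have := sq_nonneg (‖DampedNLS.iterSolution N η u₀ β τ Ψ k ω‖ ^ p - 1)
        have h5 := pow_nonneg (norm_nonneg (DampedNLS.iterSolution N η u₀ β τ Ψ k ω)) p
        rw [mul_comm 2 p, pow_mul]
        nlinarith
    _ = 1 + ∫ ω, ‖DampedNLS.iterSolution N η u₀ β τ Ψ k ω‖ ^ (2 * p) ∂P := by
        rw [integral_add (integrable_const _) (hi _)]; simp
    _ ≤ 1 + K p ‖DampedNLS.proj N u₀‖ := add_le_add le_rfl (hbound p)
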